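/- Let $M$ be a closed (compact, without boundary) smooth surface with a smooth Riemannian metric of constant Gaussian curvature. By a closed geodesic we mean a non-constant periodic geodesic $\gamma:\mathbb R\to M$, traversed once during its least period $T$. Let $\gamma_1,\dots,\gamma_n$ be closed geodesics on $M$ with pairwise distinct images, and let $K\subset M$ be the union of these images. Suppose that $(M,K)$ is an atom, that is: $K$ is a connected finite graph (loops and multiple edges are allowed) embedded in $M$, each of its vertices has degree $4$, each connected component of $M\setminus K$ (cell) is homeomorphic to an open disc, and the cells can be coloured in two colours so that each edge is incident to cells of different colours. Then: (1) Every intersection point of the geodesics (self-intersections included) is simple, that is, a transversal double point: exactly two passages of the geodesics $\gamma_1,\dots,\gamma_n$, each traversed once, go through it, and the velocity vectors of the two passages are linearly independent. (2) For each $i$, the set of points of $\gamma_i$ that lie also on some $\gamma_j$ with $j\ne i$ is finite, and traversing $\gamma_i$ once reverses the local orientation if and only if the number of these points is odd (self-intersection points of $\gamma_i$ are not counted). Here traversing $\gamma_i$ once reverses the local orientation if a unit vector orthogonal to $\gamma_i'$, carried continuously along $\gamma_i$ for one period, returns with the opposite direction. -/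

import Mathlib

open Set
open scoped Manifold ContDiff

namespace GeodesicAtoms

noncomputable section

/-- The model plane of a surface. -/
abbrev Plane : Type := EuclideanSpace ℝ (Fin 2)

/-! ### Local Riemannian geometry of a metric given by its coefficients on the plane -/

/-- The partial derivative `∂ᵢ f` at `y`. -/
def partialDeriv (i : Fin 2) (f : Plane → ℝ) (y : Plane) : ℝ :=
  fderiv ℝ f y (EuclideanSpace.single i 1)

/-- The Christoffel symbol `Γᵏᵢⱼ = ½ ∑ₗ gᵏˡ (∂ᵢ gⱼₗ + ∂ⱼ gᵢₗ - ∂ₗ gᵢⱼ)` of the metric with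
coefficient matrix `G`. -/
def christoffel (G : Plane → Matrix (Fin 2) (Fin 2) ℝ) (k i j : Fin 2) (y : Plane) : ℝ :=
  (1 / 2 : ℝ) * ∑ l, (G y)⁻¹ k l *
    (partialDeriv i (fun z => G z j l) y + partialDeriv j (fun z => G z i l) y
      - partialDeriv l (fun z => G z i j) y)

/-- The component `Rˡᵢⱼₖ` of the curvature tensor, `R(∂ⱼ, ∂ₖ) ∂ᵢ = ∑ₗ Rˡᵢⱼₖ ∂ₗ`. -/
def riemann (G : Plane → Matrix (Fin 2) (Fin 2) ℝ) (l i j k : Fin 2) (y : Plane) : ℝ :=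
  partialDeriv j (christoffel G l i k) y - partialDeriv k (christoffel G l i j) y
    + ∑ m, (christoffel G l j m y * christoffel G m i k y
      - christoffel G l k m y * christoffel G m i j y)

/-- The Gaussian curvature `⟨R(∂₀, ∂₁) ∂₁, ∂₀⟩ / det G`. -/
def gaussCurvature (G : Plane → Matrix (Fin 2) (Fin 2) ℝ) (y : Plane) : ℝ :=
  (∑ l, G y 0 l * riemann G l 1 0 1 y) / (G y).det

/-! ### Riemannian surfaces, geodesics -/

section Surface

variable {M : Type*} [TopologicalSpace M] [ChartedSpace Plane M] [IsManifold 𝓘(ℝ, Plane) ∞ M]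

/-- A smooth Riemannian metric on the surface `M`. -/
abbrev SurfaceMetric (M : Type*) [TopologicalSpace M] [ChartedSpace Plane M]
    [IsManifold 𝓘(ℝ, Plane) ∞ M] :=
  Bundle.ContMDiffRiemannianMetric 𝓘(ℝ, Plane) ∞ Plane
    (fun x : M => TangentSpace 𝓘(ℝ, Plane) x)

/-- The coefficients `gᵢⱼ` of the metric in the chart `φ` (meaningful on `φ.target`). -/
def coeff (g : SurfaceMetric M) (φ : OpenPartialHomeomorph M Plane) (y : Plane) :
    Matrix (Fin 2) (Fin 2) ℝ :=
  Matrix.of fun i j => g.inner (φ.symm y)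
    (mfderiv 𝓘(ℝ, Plane) 𝓘(ℝ, Plane) φ.symm y (EuclideanSpace.single i (1 : ℝ) : Plane))
    (mfderiv 𝓘(ℝ, Plane) 𝓘(ℝ, Plane) φ.symm y (EuclideanSpace.single j (1 : ℝ) : Plane))

/-- The metric has constant Gaussian curvature. -/
def HasConstantCurvature (g : SurfaceMetric M) : Prop :=
  ∃ κ : ℝ, ∀ φ ∈ IsManifold.maximalAtlas 𝓘(ℝ, Plane) ∞ M, ∀ y ∈ φ.target,
    gaussCurvature (coeff g φ) y = κ

/-- A smooth curve is a geodesic if it satisfies the geodesic equation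
`uₖ'' + ∑ᵢⱼ Γᵏᵢⱼ(u) uᵢ' uⱼ' = 0` in every local chart. -/
def IsGeodesic (g : SurfaceMetric M) (γ : ℝ → M) : Prop :=
  ContMDiff 𝓘(ℝ, ℝ) 𝓘(ℝ, Plane) ∞ γ ∧
    ∀ φ ∈ IsManifold.maximalAtlas 𝓘(ℝ, Plane) ∞ M, ∀ t : ℝ, γ t ∈ φ.source → ∀ k : Fin 2,
      deriv (deriv fun s => φ (γ s) k) t
        + ∑ i, ∑ j, christoffel (coeff g φ) k i j (φ (γ t))
          * deriv (fun s => φ (γ s) i) t * deriv (fun s => φ (γ s) j) t = 0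

/-- A closed geodesic, parametrized periodically by `ℝ` and traversed once during its least
period. The existence of a least positive period excludes constant curves. -/
structure ClosedGeodesic (g : SurfaceMetric M) where
  /-- The parametrized curve. -/
  curve : ℝ → M
  /-- The least period. -/
  period : ℝ
  isGeodesic : IsGeodesic g curve
  period_pos : 0 < period
  periodic : Function.Periodic curve period
  period_le : ∀ s : ℝ, 0 < s → Function.Periodic curve s → period ≤ s

/-- The image of a closed geodesic. -/
def ClosedGeodesic.image {g : SurfaceMetric M} (γ : ClosedGeodesic g) : Set M := range γ.curve

/-- The velocity vector `γ'(t)`. -/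
def velocity (γ : ℝ → M) (t : ℝ) : TangentSpace 𝓘(ℝ, Plane) (γ t) :=
  mfderiv 𝓘(ℝ, ℝ) 𝓘(ℝ, Plane) γ t (1 : ℝ)

/-- The velocity vector at time `t` of a curve passing through `p` at this time, as a vector
tangent to the surface at `p`. -/
def velocityAt {γ : ℝ → M} {t : ℝ} {p : M} (h : γ t = p) : TangentSpace 𝓘(ℝ, Plane) p :=
  h ▸ velocity γ t

/-- Traversing the closed geodesic once reverses the local orientation: a unit vector orthogonal to
the velocity, deformed continuously along the curve, returns with the opposite direction. -/
def ReversesOrientation {g : SurfaceMetric M} (γ : ClosedGeodesic g) : Prop :=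
  ∃ ν : (t : ℝ) → TangentSpace 𝓘(ℝ, Plane) (γ.curve t),
    (Continuous fun t => (⟨γ.curve t, ν t⟩ : TangentBundle 𝓘(ℝ, Plane) M)) ∧
    (∀ t, g.inner (γ.curve t) (ν t) (ν t) = 1) ∧
    (∀ t, g.inner (γ.curve t) (velocity γ.curve t) (ν t) = 0) ∧
    (⟨γ.curve γ.period, ν γ.period⟩ : TangentBundle 𝓘(ℝ, Plane) M) = ⟨γ.curve 0, -ν 0⟩

/-! ### Intersection points of a family of closed geodesics -/

variable {g : SurfaceMetric M} {n : ℕ}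

/-- The passages of the family through `p`: pairs `(i, t)` with `t` in one period of the `i`-th
geodesic, which is at `p` at time `t`. -/
def passages (γ : Fin n → ClosedGeodesic g) (p : M) : Set (Fin n × ℝ) :=
  {q | q.2 ∈ Ico 0 (γ q.1).period ∧ (γ q.1).curve q.2 = p}

/-- `p` is a point of intersection or self-intersection of the family. -/
def IsIntersectionPoint (γ : Fin n → ClosedGeodesic g) (p : M) : Prop :=
  (passages γ p).Nontrivial

/-- `p` is a simple intersection point: a transversal double point. -/
def IsSimpleIntersection (γ : Fin n → ClosedGeodesic g) (p : M) : Prop :=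
  (passages γ p).encard = 2 ∧
    ∀ (q r : Fin n × ℝ) (hq : q ∈ passages γ p) (hr : r ∈ passages γ p), q ≠ r →
      LinearIndependent ℝ ![velocityAt hq.2, velocityAt hr.2]

/-- The points in which the `i`-th geodesic meets the other geodesics of the family. -/
def intersectionsWithOthers (γ : Fin n → ClosedGeodesic g) (i : Fin n) : Set M :=
  {p | p ∈ (γ i).image ∧ ∃ j, j ≠ i ∧ p ∈ (γ j).image}

end Surface

/-! ### Atoms -/

/-- A finite graph (loops and multiple edges are allowed) embedded in a topological space. -/
structure EmbeddedGraph (M : Type*) [TopologicalSpace M] where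
  /-- The vertices. -/
  vertices : Set M
  finite_vertices : vertices.Finite
  /-- The number of edges. -/
  numEdges : ℕ
  /-- The edges. -/
  edge : Fin numEdges → C(unitInterval, M)
  source_mem : ∀ e, edge e 0 ∈ vertices
  target_mem : ∀ e, edge e 1 ∈ vertices
  injOn : ∀ e, InjOn (edge e) (Ioo 0 1)
  interior_disjoint_vertices : ∀ e, Disjoint (edge e '' Ioo 0 1) vertices
  interior_disjoint : ∀ e f, e ≠ f → Disjoint (edge e '' Ioo 0 1) (edge f '' Ioo 0 1)

namespace EmbeddedGraph

variable {M : Type*} [TopologicalSpace M]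

/-- The subset of the space covered by the graph. -/
def support (Γ : EmbeddedGraph M) : Set M := Γ.vertices ∪ ⋃ e, range (Γ.edge e)

/-- An edge without its endpoints. -/
def openEdge (Γ : EmbeddedGraph M) (e : Fin Γ.numEdges) : Set M := Γ.edge e '' Ioo 0 1

/-- The degree of a vertex: the number of edge ends at it (a loop counts twice). -/
def degree (Γ : EmbeddedGraph M) (v : M) : ℕ :=
  {e | Γ.edge e 0 = v}.ncard + {e | Γ.edge e 1 = v}.ncard

/-- The cells: the connected components of the complement of the graph. -/
def cells (Γ : EmbeddedGraph M) : Set (Set M) :=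
  {C | ∃ x ∈ Γ.supportᶜ, C = connectedComponentIn Γ.supportᶜ x}

/-- The cell `C` is incident to the edge `e`. -/
def Incident (Γ : EmbeddedGraph M) (e : Fin Γ.numEdges) (C : Set M) : Prop :=
  C ∈ Γ.cells ∧ Γ.openEdge e ⊆ closure C

end EmbeddedGraph

/-- The pair `(M, K)` is an atom, for a closed surface `M`: the set `K` is a connected finite graph
of degree 4 embedded in `M`, whose complement consists of open discs (cells) that can be coloured in
two colours so that each edge is incident to cells of different colours. -/
def IsGraphAtom {M : Type*} [TopologicalSpace M] (K : Set M) : Prop :=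
  ∃ Γ : EmbeddedGraph M, Γ.support = K ∧
    IsConnected K ∧
    (∀ v ∈ Γ.vertices, Γ.degree v = 4) ∧
    (∀ C ∈ Γ.cells, Nonempty (C ≃ₜ Metric.ball (0 : Plane) 1)) ∧
    ∃ color : Set M → Bool, ∀ e, ∃ C D : Set M,
      Γ.Incident e C ∧ Γ.Incident e D ∧ color C ≠ color D

end

end GeodesicAtoms

set_option linter.unusedSectionVars false
set_option linter.unusedVariables false

/-! A geodesic is determined by its position and velocity at one time. Hence two different passages
through the same point never have parallel velocities: otherwise one would be an affine
reparametrization of the other. For two different geodesics this makes the images equal; for a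
single one it gives either a period that is too short or a reversal of direction with zero velocity
at the turning point (`planeVelocity_ne_smul_of_ne`).

So k passages through `p` yield 2k short half-branches at `p`, pairwise disjoint and free of
vertices. The edges of the graph are only continuous, so they are compared with the geodesics
topologically: a connected piece of the graph without vertices whose closure contains `p` follows
one edge into `p`, and disjoint pieces use different edge ends (`card_le_ncard_endsAt`). There are
at most four ends at a vertex and at most two elsewhere. Therefore a point with two passages is a
vertex and has exactly two (`two_mul_card_passages_le`, `passages_encard_eq_two`).

For the orientation, let `w` be the unit normal along a geodesic that points to the cells of colour
`true`. In a chart whose first axis is the geodesic, the graph is this axis or, at an intersection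
point, both axes. Regions separated by a piece of the graph have opposite colours, so the colour on
a fixed side switches exactly at the intersection points (`exists_isColoredChart`). Thus `w` jumps
to its negative there, and multiplying by `crossingSign` makes it continuous. Since `w` itself is
periodic, going round once multiplies the continuous normal by (-1)^N, with N the number of times in
a period spent at intersection points (`reversesOrientation_iff`). A self-intersection contributes 2
to N and an intersection with another geodesic contributes 1, which gives the parity claim
(`odd_ncard_passages_iff`). -/

namespace GeodesicAtoms

open Filter Topology

/-! ### Smoothness of the metric in charts. -/

section Charts

variable {M : Type*} [TopologicalSpace M] [ChartedSpace Plane M] [IsManifold 𝓘(ℝ, Plane) ∞ M]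

open IsManifold in
/-- The inverse of a chart maps a smooth family of vectors of the plane to a smooth family of
tangent vectors of the surface. -/
theorem contMDiffOn_mfderiv_symm {φ : OpenPartialHomeomorph M Plane}
    (hφ : φ ∈ maximalAtlas 𝓘(ℝ, Plane) ∞ M) {v : Plane → Plane} (hv : ContDiffOn ℝ ∞ v φ.target) :
    ContMDiffOn 𝓘(ℝ, Plane) (𝓘(ℝ, Plane).prod 𝓘(ℝ, Plane)) ∞
      (fun y => (⟨φ.symm y, mfderiv 𝓘(ℝ, Plane) 𝓘(ℝ, Plane) φ.symm y (v y)⟩ :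
        TangentBundle 𝓘(ℝ, Plane) M)) φ.target := by
  have h1 := (contMDiffOn_symm_of_mem_maximalAtlas hφ).contMDiffOn_tangentMapWithin
    (m := ∞) (by simp) φ.open_target.uniqueMDiffOn
  have h2 : ContMDiffOn 𝓘(ℝ, Plane) (𝓘(ℝ, Plane).prod 𝓘(ℝ, Plane)) ∞
      (fun y => (⟨y, v y⟩ : TangentBundle 𝓘(ℝ, Plane) Plane)) φ.target :=
    contMDiffOn_vectorSpace_iff_contDiffOn.2 hv
  refine (h1.comp h2 fun y hy => hy).congr fun y hy => ?_
  simp only [Function.comp_apply, tangentMapWithin]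
  rw [mfderivWithin_of_isOpen φ.open_target hy]

-- Arbitrary smooth fields are allowed because the lemma serves both the metric coefficients and the
-- squared length of a non-constant normal direction.
open IsManifold in
theorem contDiffOn_inner_mfderiv_symm (g : SurfaceMetric M) {φ : OpenPartialHomeomorph M Plane}
    (hφ : φ ∈ maximalAtlas 𝓘(ℝ, Plane) ∞ M) {v w : Plane → Plane}
    (hv : ContDiffOn ℝ ∞ v φ.target) (hw : ContDiffOn ℝ ∞ w φ.target) :
    ContDiffOn ℝ ∞ (fun y => g.inner (φ.symm y)
      (mfderiv 𝓘(ℝ, Plane) 𝓘(ℝ, Plane) φ.symm y (v y))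
      (mfderiv 𝓘(ℝ, Plane) 𝓘(ℝ, Plane) φ.symm y (w y))) φ.target := by
  intro y hy
  have hv' := contMDiffOn_mfderiv_symm hφ hv y hy
  have hw' := contMDiffOn_mfderiv_symm hφ hw y hy
  have hb : ContMDiffWithinAt 𝓘(ℝ, Plane) 𝓘(ℝ, Plane) ∞ φ.symm φ.target y :=
    contMDiffOn_symm_of_mem_maximalAtlas hφ y hy
  have h : ContMDiffWithinAt 𝓘(ℝ, Plane) (𝓘(ℝ, Plane).prod 𝓘(ℝ)) ∞
      (fun y => Bundle.TotalSpace.mk' ℝ (E := Bundle.Trivial M ℝ) (φ.symm y)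
        (g.inner (φ.symm y) (mfderiv 𝓘(ℝ, Plane) 𝓘(ℝ, Plane) φ.symm y (v y))
          (mfderiv 𝓘(ℝ, Plane) 𝓘(ℝ, Plane) φ.symm y (w y)))) φ.target y :=
    ContMDiffWithinAt.clm_bundle_apply₂ (F₁ := Plane) (F₂ := Plane)
      (E₁ := fun x : M => TangentSpace 𝓘(ℝ, Plane) x)
      (E₂ := fun x : M => TangentSpace 𝓘(ℝ, Plane) x)
      (ContMDiffAt.comp_contMDiffWithinAt y g.contMDiff.contMDiffAt hb) hv' hw'
  simp only [Bundle.contMDiffWithinAt_totalSpace] at h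
  exact h.2.contDiffWithinAt

open IsManifold in
theorem contDiffOn_coeff (g : SurfaceMetric M) {φ : OpenPartialHomeomorph M Plane}
    (hφ : φ ∈ maximalAtlas 𝓘(ℝ, Plane) ∞ M) (i j : Fin 2) :
    ContDiffOn ℝ ∞ (fun y => coeff g φ y i j) φ.target :=
  contDiffOn_inner_mfderiv_symm g hφ contDiffOn_const contDiffOn_const

end Charts

/-! ### Derivatives of charts; the geodesic equation as a first-order system. -/

section Charts

variable {M : Type*} [TopologicalSpace M] [ChartedSpace Plane M] [IsManifold 𝓘(ℝ, Plane) ∞ M]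

theorem mdifferentiable_of_mem_maximalAtlas {φ : OpenPartialHomeomorph M Plane}
    (hφ : φ ∈ IsManifold.maximalAtlas 𝓘(ℝ, Plane) ∞ M) :
    φ.MDifferentiable 𝓘(ℝ, Plane) 𝓘(ℝ, Plane) :=
  ⟨(contMDiffOn_of_mem_maximalAtlas hφ).mdifferentiableOn (by simp),
    (contMDiffOn_symm_of_mem_maximalAtlas hφ).mdifferentiableOn (by simp)⟩

theorem mfderiv_symm_mfderiv {φ : OpenPartialHomeomorph M Plane}
    (hφ : φ ∈ IsManifold.maximalAtlas 𝓘(ℝ, Plane) ∞ M) {y : Plane} (hy : y ∈ φ.target)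
    (v : Plane) :
    (mfderiv 𝓘(ℝ, Plane) 𝓘(ℝ, Plane) φ (φ.symm y)
      (mfderiv 𝓘(ℝ, Plane) 𝓘(ℝ, Plane) φ.symm y v) : Plane) = v :=
  congrArg (fun L => L v) ((mdifferentiable_of_mem_maximalAtlas hφ).comp_symm_deriv hy)

theorem mfderiv_mfderiv_symm {φ : OpenPartialHomeomorph M Plane}
    (hφ : φ ∈ IsManifold.maximalAtlas 𝓘(ℝ, Plane) ∞ M) {x : M} (hx : x ∈ φ.source)
    (v : Plane) :
    (mfderiv 𝓘(ℝ, Plane) 𝓘(ℝ, Plane) φ.symm (φ x)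
      (mfderiv 𝓘(ℝ, Plane) 𝓘(ℝ, Plane) φ x v) : Plane) = v :=
  congrArg (fun L => L v) ((mdifferentiable_of_mem_maximalAtlas hφ).symm_comp_deriv hx)

/-- The metric is positive definite in coordinates. -/
theorem inner_mfderiv_symm_pos (g : SurfaceMetric M) {φ : OpenPartialHomeomorph M Plane}
    (hφ : φ ∈ IsManifold.maximalAtlas 𝓘(ℝ, Plane) ∞ M) {y : Plane} (hy : y ∈ φ.target)
    {v : Plane} (hv : v ≠ 0) :
    0 < g.inner (φ.symm y) (mfderiv 𝓘(ℝ, Plane) 𝓘(ℝ, Plane) φ.symm y v)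
      (mfderiv 𝓘(ℝ, Plane) 𝓘(ℝ, Plane) φ.symm y v) := by
  refine g.pos _ _ fun h => hv ?_
  have := mfderiv_symm_mfderiv hφ hy v
  rw [h] at this
  rw [← this]
  exact map_zero _

/-- The vector g₀₀ e₁ - g₀₁ e₀ is nonzero and has squared length g₀₀ · det, so positive definiteness
excludes det = 0. -/
theorem det_coeff_ne_zero (g : SurfaceMetric M) {φ : OpenPartialHomeomorph M Plane}
    (hφ : φ ∈ IsManifold.maximalAtlas 𝓘(ℝ, Plane) ∞ M) {y : Plane} (hy : y ∈ φ.target) :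
    (coeff g φ y).det ≠ 0 := by
  intro h0
  set L := mfderiv 𝓘(ℝ, Plane) 𝓘(ℝ, Plane) φ.symm y with hL
  set e0 : TangentSpace 𝓘(ℝ, Plane) y := (EuclideanSpace.single 0 (1 : ℝ) : Plane)
  set e1 : TangentSpace 𝓘(ℝ, Plane) y := (EuclideanSpace.single 1 (1 : ℝ) : Plane)
  have h00 : coeff g φ y 0 0 = g.inner (φ.symm y) (L e0) (L e0) := rfl
  have h01 : coeff g φ y 0 1 = g.inner (φ.symm y) (L e0) (L e1) := rfl
  have h10 : coeff g φ y 1 0 = g.inner (φ.symm y) (L e1) (L e0) := rfl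
  have h11 : coeff g φ y 1 1 = g.inner (φ.symm y) (L e1) (L e1) := rfl
  have hs : coeff g φ y 1 0 = coeff g φ y 0 1 := g.symm _ _ _
  have hp : 0 < coeff g φ y 0 0 := by
    refine inner_mfderiv_symm_pos g hφ hy (v := EuclideanSpace.single 0 (1 : ℝ)) fun h => ?_
    simpa using congrArg (fun v : Plane => v 0) h
  have hne : (coeff g φ y 0 0 • e1 - coeff g φ y 0 1 • e0 : Plane) ≠ 0 := fun h => by
    have := congrArg (fun v : Plane => v 1) h
    have h' : coeff g φ y 0 0 * (EuclideanSpace.single 1 (1 : ℝ) : Plane) 1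
      - coeff g φ y 0 1 * (EuclideanSpace.single 0 (1 : ℝ) : Plane) 1 = 0 := this
    simp at h'
    linarith
  have hpos := inner_mfderiv_symm_pos g hφ hy hne
  have : g.inner (φ.symm y) (L (coeff g φ y 0 0 • e1 - coeff g φ y 0 1 • e0))
      (L (coeff g φ y 0 0 • e1 - coeff g φ y 0 1 • e0)) = 0 := by
    rw [Matrix.det_fin_two] at h0
    simp only [map_sub, map_smul, sub_apply, smul_apply,
      ← h00, ← h01, ← h10, ← h11, smul_eq_mul]
    linear_combination (coeff g φ y 0 0) * h0
  exact hpos.ne' this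

theorem contDiffOn_partialDeriv {f : Plane → ℝ} {s : Set Plane} (hs : IsOpen s)
    (hf : ContDiffOn ℝ ∞ f s) (i : Fin 2) : ContDiffOn ℝ ∞ (partialDeriv i f) s :=
  (hf.fderiv_of_isOpen hs (by simp)).clm_apply contDiffOn_const

theorem contDiffOn_christoffel (g : SurfaceMetric M) {φ : OpenPartialHomeomorph M Plane}
    (hφ : φ ∈ IsManifold.maximalAtlas 𝓘(ℝ, Plane) ∞ M) (k i j : Fin 2) :
    ContDiffOn ℝ ∞ (christoffel (coeff g φ) k i j) φ.target := by
  have hd : ContDiffOn ℝ ∞ (fun y => (coeff g φ y).det⁻¹) φ.target := by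
    refine ContDiffOn.inv ?_ fun y hy => det_coeff_ne_zero g hφ hy
    simp only [Matrix.det_fin_two]
    exact ((contDiffOn_coeff g hφ 0 0).mul (contDiffOn_coeff g hφ 1 1)).sub
      ((contDiffOn_coeff g hφ 0 1).mul (contDiffOn_coeff g hφ 1 0))
  have hi : ∀ k l, ContDiffOn ℝ ∞ (fun y => (coeff g φ y)⁻¹ k l) φ.target := by
    intro k l
    simp only [Matrix.inv_def, Ring.inverse_eq_inv', Matrix.adjugate_fin_two, Matrix.smul_apply,
      smul_eq_mul]
    refine hd.mul ?_
    have h := contDiffOn_coeff g hφ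
    fin_cases k <;> fin_cases l
    exacts [h 1 1, (h 0 1).neg, (h 1 0).neg, h 0 0]
  have hp : ∀ i j l, ContDiffOn ℝ ∞ (partialDeriv i fun z => coeff g φ z j l) φ.target :=
    fun i j l => contDiffOn_partialDeriv φ.open_target (contDiffOn_coeff g hφ j l) i
  unfold christoffel
  exact contDiffOn_const.mul (ContDiffOn.sum fun l _ =>
    (hi k l).mul (((hp i j l).add (hp j i l)).sub (hp l i j)))

/-- The vector field on the tangent bundle of the plane whose integral curves are the geodesics. -/
noncomputable def geodesicField (G : Plane → Matrix (Fin 2) (Fin 2) ℝ) (p : Plane × Plane) :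
    Plane × Plane :=
  (p.2, WithLp.toLp 2 fun k => -∑ i, ∑ j, christoffel G k i j p.1 * p.2 i * p.2 j)

/-- Class C¹ gives a local Lipschitz constant, which is what uniqueness of solutions needs. -/
theorem contDiffAt_geodesicField (g : SurfaceMetric M) {φ : OpenPartialHomeomorph M Plane}
    (hφ : φ ∈ IsManifold.maximalAtlas 𝓘(ℝ, Plane) ∞ M) {p : Plane × Plane} (hp : p.1 ∈ φ.target) :
    ContDiffAt ℝ 1 (geodesicField (coeff g φ)) p := by
  refine contDiffAt_snd.prodMk ?_
  rw [contDiffAt_euclidean]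
  intro k
  have h2 : ∀ i, ContDiffAt ℝ 1 (fun p : Plane × Plane => p.2 i) p := fun i =>
    (contDiffAt_euclidean.1 (contDiffAt_snd (p := p)) i)
  refine (ContDiffAt.sum fun i _ => ContDiffAt.sum fun j _ => ContDiffAt.mul (ContDiffAt.mul ?_
    (h2 i)) (h2 j)).neg
  have := ((contDiffOn_christoffel g hφ k i j).contDiffAt (φ.open_target.mem_nhds hp)).of_le
    (m := 1) (by simp)
  exact this.comp p contDiffAt_fst

variable {γ δ : ℝ → M}

theorem hasDerivAt_chart {φ : OpenPartialHomeomorph M Plane}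
    (hφ : φ ∈ IsManifold.maximalAtlas 𝓘(ℝ, Plane) ∞ M) {t : ℝ}
    (hγ : MDifferentiableAt 𝓘(ℝ, ℝ) 𝓘(ℝ, Plane) γ t) (ht : γ t ∈ φ.source) :
    HasDerivAt (fun s => φ (γ s))
      (mfderiv 𝓘(ℝ, Plane) 𝓘(ℝ, Plane) φ (γ t) (velocity γ t) : Plane) t := by
  have h := ((mdifferentiable_of_mem_maximalAtlas hφ).mdifferentiableAt ht).hasMFDerivAt.comp t
    hγ.hasMFDerivAt
  have h' : HasFDerivAt (fun s => φ (γ s)) ((mfderiv 𝓘(ℝ, Plane) 𝓘(ℝ, Plane) φ (γ t)).comp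
    (mfderiv 𝓘(ℝ, ℝ) 𝓘(ℝ, Plane) γ t) : ℝ →L[ℝ] Plane) t := h.hasFDerivAt
  have key : ∀ (L : ℝ →L[ℝ] Plane) (f : ℝ → Plane), HasFDerivAt f L t → HasDerivAt f (L 1) t :=
    fun L f h => h.hasDerivAt
  exact key _ _ h'

theorem contDiffAt_chart {φ : OpenPartialHomeomorph M Plane}
    (hφ : φ ∈ IsManifold.maximalAtlas 𝓘(ℝ, Plane) ∞ M) {t : ℝ}
    (hγ : ContMDiff 𝓘(ℝ, ℝ) 𝓘(ℝ, Plane) ∞ γ) (ht : γ t ∈ φ.source) :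
    ContDiffAt ℝ ∞ (fun s => φ (γ s)) t :=
  ((contMDiffAt_of_mem_maximalAtlas hφ ht).comp t hγ.contMDiffAt).contDiffAt

end Charts

/-! ### Uniqueness and affine reparametrization of geodesics. -/

section Geodesics

variable {M : Type*} [TopologicalSpace M] [ChartedSpace Plane M] [IsManifold 𝓘(ℝ, Plane) ∞ M]
  {g : SurfaceMetric M} {γ δ : ℝ → M}

theorem IsGeodesic.mdifferentiableAt (hγ : IsGeodesic g γ) (t : ℝ) :
    MDifferentiableAt 𝓘(ℝ, ℝ) 𝓘(ℝ, Plane) γ t :=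
  hγ.1.mdifferentiableAt (by simp)

theorem IsGeodesic.continuous (hγ : IsGeodesic g γ) : Continuous γ := hγ.1.continuous

theorem deriv_euclidean_apply {f : ℝ → Plane} {t : ℝ} (hf : DifferentiableAt ℝ f t) (k : Fin 2) :
    deriv (fun s => f s k) t = deriv f t k :=
  (((EuclideanSpace.proj k : Plane →L[ℝ] ℝ).hasFDerivAt).comp_hasDerivAt t hf.hasDerivAt).deriv

theorem IsGeodesic.hasDerivAt_geodesicField (hγ : IsGeodesic g γ)
    {φ : OpenPartialHomeomorph M Plane} (hφ : φ ∈ IsManifold.maximalAtlas 𝓘(ℝ, Plane) ∞ M) {t : ℝ}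
    (ht : γ t ∈ φ.source) :
    HasDerivAt (fun s => (φ (γ s), deriv (fun s => φ (γ s)) s))
      (geodesicField (coeff g φ) (φ (γ t), deriv (fun s => φ (γ s)) t)) t := by
  set x : ℝ → Plane := fun s => φ (γ s) with hx
  have hc : ContDiffAt ℝ ∞ x t := contDiffAt_chart hφ hγ.1 ht
  have hd : DifferentiableAt ℝ x t := hc.differentiableAt (by simp)
  -- The geodesic equation differentiates components twice. Identifying these with components of the
  -- second derivative requires differentiability near `t`, not only at `t`.
  have hev : ∀ᶠ s in 𝓝 t, DifferentiableAt ℝ x s := by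
    filter_upwards [hγ.continuous.continuousAt.preimage_mem_nhds (φ.open_source.mem_nhds ht)]
      with s hs
    exact (contDiffAt_chart hφ hγ.1 hs).differentiableAt (by simp)
  have hd2 : DifferentiableAt ℝ (deriv x) t := by
    have : ContDiffAt ℝ 1 (fderiv ℝ x) t := hc.fderiv_right (m := 1) (by decide)
    exact (this.clm_apply contDiffAt_const).differentiableAt (by simp)
  refine hd.hasDerivAt.prodMk ?_
  convert hd2.hasDerivAt using 1
  ext k
  have hg := hγ.2 φ hφ t ht k
  have h2 : deriv (deriv fun s => x s k) t = deriv (deriv x) t k := by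
    rw [← deriv_euclidean_apply hd2]
    refine EventuallyEq.deriv_eq ?_
    filter_upwards [hev] with s hs using deriv_euclidean_apply hs k
  have h1 : ∀ i, deriv (fun s => φ (γ s) i) t = deriv x t i := fun i => deriv_euclidean_apply hd i
  simp only [h1] at hg
  change deriv (deriv fun s => x s k) t + _ = 0 at hg
  rw [h2] at hg
  change -∑ i, ∑ j, christoffel (coeff g φ) k i j (x t) * deriv x t i * deriv x t j = _
  linarith

/-- Both phase curves solve the same first-order system with the same initial value and stay near
`t` in a set where the field is Lipschitz. Injectivity of the chart brings the equality back to the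
surface. -/
theorem IsGeodesic.eventuallyEq (hγ : IsGeodesic g γ) (hδ : IsGeodesic g δ)
    {φ : OpenPartialHomeomorph M Plane} (hφ : φ ∈ IsManifold.maximalAtlas 𝓘(ℝ, Plane) ∞ M) {t : ℝ}
    (ht : γ t ∈ φ.source) (h0 : γ t = δ t)
    (h1 : deriv (fun s => φ (γ s)) t = deriv (fun s => φ (δ s)) t) : γ =ᶠ[𝓝 t] δ := by
  obtain ⟨K, s, hs, hK⟩ := (contDiffAt_geodesicField g hφ (p := (φ (γ t),
    deriv (fun s => φ (γ s)) t)) (φ.map_source ht)).exists_lipschitzOnWith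
  have key : ∀ {η : ℝ → M}, IsGeodesic g η → γ t = η t →
      deriv (fun s => φ (γ s)) t = deriv (fun s => φ (η s)) t → ∀ᶠ u in 𝓝 t, η u ∈ φ.source ∧
      HasDerivAt (fun s => (φ (η s), deriv (fun s => φ (η s)) s))
        (geodesicField (coeff g φ) (φ (η u), deriv (fun s => φ (η s)) u)) u ∧
      (φ (η u), deriv (fun s => φ (η s)) u) ∈ s := by
    intro η hη e0 e1
    have hη0 : η t ∈ φ.source := e0 ▸ ht
    have hc := (hη.hasDerivAt_geodesicField hφ hη0).continuousAt
    rw [e0, e1] at hs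
    filter_upwards [hη.continuous.continuousAt.preimage_mem_nhds (φ.open_source.mem_nhds hη0),
      hc.preimage_mem_nhds hs] with u hu hu'
    exact ⟨hu, hη.hasDerivAt_geodesicField hφ hu, hu'⟩
  have hg := key hγ rfl rfl
  have hd := key hδ h0 h1
  have := ODE_solution_unique_of_eventually (K := K) (t₀ := t)
    (v := fun _ => geodesicField (coeff g φ)) (s := fun _ => s) (Eventually.of_forall fun _ => hK)
    (hg.mono fun _ h => h.2) (hd.mono fun _ h => h.2) (by simp only [h1]; rw [h0])
  filter_upwards [this, hg, hd] with u hu hgu hdu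
  exact φ.injOn hgu.1 hdu.1 (congrArg Prod.fst hu)

theorem deriv_chart {φ : OpenPartialHomeomorph M Plane}
    (hφ : φ ∈ IsManifold.maximalAtlas 𝓘(ℝ, Plane) ∞ M) {t : ℝ}
    (hγ : MDifferentiableAt 𝓘(ℝ, ℝ) 𝓘(ℝ, Plane) γ t) (ht : γ t ∈ φ.source) :
    deriv (fun s => φ (γ s)) t =
      (mfderiv 𝓘(ℝ, Plane) 𝓘(ℝ, Plane) φ (γ t) (velocity γ t) : Plane) :=
  (hasDerivAt_chart hφ hγ ht).deriv

/-- Two geodesics through a point with the same velocity coincide. -/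
theorem IsGeodesic.eq_of_velocity_eq [T2Space M] (hγ : IsGeodesic g γ) (hδ : IsGeodesic g δ) {t : ℝ}
    (h0 : γ t = δ t) (h1 : (velocity γ t : Plane) = (velocity δ t : Plane)) : γ = δ := by
  have hclopen : IsClopen {s | γ =ᶠ[𝓝 s] δ} := by
    refine ⟨isClosed_iff_clusterPt.2 fun s hs => ?_, isOpen_setOfPred_eventually_nhds⟩
    -- At a limit `s` of times where the germs agree, positions agree because `M` is Hausdorff, and
    -- coordinate velocities agree by continuity. Local uniqueness then makes the germs agree at
    -- `s`.
    have hfr : ∃ᶠ u in 𝓝 s, γ =ᶠ[𝓝 u] δ := by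
      rwa [clusterPt_principal_iff_frequently] at hs
    have hs0 : γ s = δ s := by
      have hcl : IsClosed {u | γ u = δ u} := isClosed_eq hγ.continuous hδ.continuous
      exact hcl.closure_subset (mem_closure_iff_frequently.2 (hfr.mono fun u hu => hu.self_of_nhds))
    have hφ := IsManifold.chart_mem_maximalAtlas (I := 𝓘(ℝ, Plane)) (n := ∞) (γ s)
    have hsrc := mem_chart_source Plane (γ s)
    refine hγ.eventuallyEq hδ hφ hsrc hs0 ?_
    have cg := (hγ.hasDerivAt_geodesicField hφ hsrc).continuousAt.snd
    have cd := (hδ.hasDerivAt_geodesicField hφ (t := s) (by rw [← hs0]; exact hsrc)).continuousAt.snd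
    by_contra hne
    have := (cg.tendsto.prodMk_nhds cd.tendsto).eventually
      ((isClosed_diagonal.isOpen_compl).mem_nhds (show (_, _) ∈ (diagonal Plane)ᶜ from hne))
    obtain ⟨u, hu, hu'⟩ := (hfr.and_eventually this).exists
    refine hu' (show _ = _ from EventuallyEq.deriv_eq ?_)
    filter_upwards [hu] with v hv
    rw [hv]
  have hne : {s | γ =ᶠ[𝓝 s] δ}.Nonempty := by
    refine ⟨t, ?_⟩
    have hφ := IsManifold.chart_mem_maximalAtlas (I := 𝓘(ℝ, Plane)) (n := ∞) (γ t)
    have hsrc := mem_chart_source Plane (γ t)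
    refine hγ.eventuallyEq hδ hφ hsrc h0 ?_
    rw [deriv_chart hφ (hγ.mdifferentiableAt t) hsrc,
      deriv_chart hφ (hδ.mdifferentiableAt t) (h0 ▸ hsrc), ← h0]
    exact congrArg (fun v : Plane => (mfderiv 𝓘(ℝ, Plane) 𝓘(ℝ, Plane)
      (chartAt Plane (γ t)) (γ t) : Plane →L[ℝ] Plane) v) h1
  funext s
  have : s ∈ {s | γ =ᶠ[𝓝 s] δ} := (isClopen_iff.1 hclopen).resolve_left hne.ne_empty ▸ mem_univ s
  exact this.self_of_nhds

theorem velocity_comp {r : ℝ → ℝ} {c t : ℝ} (hr : HasDerivAt r c t)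
    (hγ : MDifferentiableAt 𝓘(ℝ, ℝ) 𝓘(ℝ, Plane) γ (r t)) :
    (velocity (fun s => γ (r s)) t : Plane) = c • (velocity γ (r t) : Plane) := by
  have h := hγ.hasMFDerivAt.comp t hr.hasFDerivAt.hasMFDerivAt
  have := h.mfderiv
  have e : (velocity (fun s => γ (r s)) t : Plane) =
    (mfderiv 𝓘(ℝ, ℝ) 𝓘(ℝ, Plane) γ (r t) : ℝ →L[ℝ] Plane) ((1 : ℝ) • c) :=
    congrArg (fun L : ℝ →L[ℝ] Plane => L 1) this
  have key : ∀ L : ℝ →L[ℝ] Plane, L ((1 : ℝ) • c) = c • L 1 := fun L => by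
    rw [← map_smul]; simp
  exact e.trans (key _)

/-- An affine reparametrization of a geodesic is a geodesic. -/
theorem IsGeodesic.comp_affine (hγ : IsGeodesic g γ) (a c : ℝ) :
    IsGeodesic g fun s => γ (a + c * s) := by
  refine ⟨hγ.1.comp (ContDiff.contMDiff (by fun_prop)), fun φ hφ t ht k => ?_⟩
  have h1 : ∀ (f : ℝ → ℝ) (s : ℝ), deriv (fun s => f (a + c * s)) s = c * deriv f (a + c * s) := by
    intro f s
    have := deriv_comp_mul_left c (fun u => f (a + u)) s
    rw [this, deriv_comp_const_add, smul_eq_mul]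
  have hg := hγ.2 φ hφ _ ht k
  have h2 : ∀ i s, deriv (fun s => φ (γ (a + c * s)) i) s
      = c * deriv (fun s => φ (γ s) i) (a + c * s) := fun i s => h1 (fun u => φ (γ u) i) s
  have h3 : deriv (deriv fun s => φ (γ (a + c * s)) k) t
      = c * (c * deriv (deriv fun s => φ (γ s) k) (a + c * t)) := by
    rw [show (deriv fun s => φ (γ (a + c * s)) k) =
      fun s => c * deriv (fun s => φ (γ s) k) (a + c * s) from funext (h2 k), deriv_const_mul_field,
      h1]
  simp only [h2, h3]
  simp only [Fin.sum_univ_two] at hg ⊢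
  linear_combination c ^ 2 * hg

end Geodesics

/-! ### Transversality of different passages. -/

section ClosedGeodesics

variable {M : Type*} [TopologicalSpace M] [ChartedSpace Plane M] [IsManifold 𝓘(ℝ, Plane) ∞ M]
  {g : SurfaceMetric M}

/-- The velocity vector, seen as a vector of the model plane. -/
noncomputable def planeVelocity (γ : ℝ → M) (t : ℝ) : Plane := velocity γ t

theorem velocityAt_eq {γ : ℝ → M} {t : ℝ} {p : M} (h : γ t = p) :
    (velocityAt h : Plane) = planeVelocity γ t := by
  subst h; rfl

theorem planeVelocity_comp {γ : ℝ → M} {r : ℝ → ℝ} {c t : ℝ} (hr : HasDerivAt r c t)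
    (hγ : MDifferentiableAt 𝓘(ℝ, ℝ) 𝓘(ℝ, Plane) γ (r t)) :
    planeVelocity (fun s => γ (r s)) t = c • planeVelocity γ (r t) :=
  velocity_comp hr hγ

/-- The factor `c` may be zero; then `γ` is constant. -/
theorem IsGeodesic.eq_affine [T2Space M] {γ δ : ℝ → M} (hγ : IsGeodesic g γ) (hδ : IsGeodesic g δ)
    {t u c : ℝ} (h0 : γ t = δ u) (h1 : planeVelocity γ t = c • planeVelocity δ u) (s : ℝ) :
    γ s = δ (u + c * (s - t)) := by
  have hr : ∀ s, (u - c * t) + c * s = u + c * (s - t) := fun s => by ring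
  have ht : (u - c * t) + c * t = u := by ring
  have hd : HasDerivAt (fun s => (u - c * t) + c * s) c t := by
    simpa using ((hasDerivAt_id t).const_mul c).const_add (u - c * t)
  have := hγ.eq_of_velocity_eq (hδ.comp_affine (u - c * t) c) (t := t) (by simpa only [ht])
    (h1.trans ((by rw [ht] : _ = _).trans
      (planeVelocity_comp hd (hδ.mdifferentiableAt _)).symm))
  rw [this]
  simp only [hr]

namespace ClosedGeodesic

theorem continuous (γ : ClosedGeodesic g) : Continuous γ.curve := γ.isGeodesic.continuous

theorem planeVelocity_periodic (γ : ClosedGeodesic g) :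
    Function.Periodic (planeVelocity γ.curve) γ.period := by
  intro t
  have hd : HasDerivAt (fun s => s + γ.period) 1 t := (hasDerivAt_id t).add_const _
  have h := planeVelocity_comp hd (γ.isGeodesic.mdifferentiableAt _)
  rw [one_smul] at h
  rw [← h]
  congr 1
  exact funext γ.periodic

variable [T2Space M]

/-- A vanishing velocity is 0 times itself, so `eq_affine` with `c = 0` makes the curve constant,
and half of the least period would be a period. -/
theorem planeVelocity_ne_zero (γ : ClosedGeodesic g) (t : ℝ) : planeVelocity γ.curve t ≠ 0 := by
  intro h0
  have h := fun s => γ.isGeodesic.eq_affine γ.isGeodesic (t := t) (u := t) (c := 0) rfl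
    (by rw [h0, smul_zero]) s
  have := γ.period_le (γ.period / 2) (half_pos γ.period_pos) fun s => by rw [h, h s]; simp
  linarith [γ.period_pos]

theorem abs_period_le (γ : ClosedGeodesic g) {s : ℝ} (hs : s ≠ 0)
    (h : Function.Periodic γ.curve s) : γ.period ≤ |s| := by
  rcases abs_choice s with h' | h'
  · exact γ.period_le _ (abs_pos.2 hs) (by rwa [h'])
  · exact γ.period_le _ (abs_pos.2 hs) (by rw [h']; exact h.neg)

/-- Parallel velocities give γ(s) = γ(u + c(s - t)) for all s. Then cT and T/c are both periods,
which forces |c| = 1. If c = 1, then t - u is a nonzero period shorter than T. If c = -1, the curve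
is symmetric about the time (t + u)/2, where its velocity equals its own negative. -/
theorem linearIndependent_of_ne (γ : ClosedGeodesic g) {t u : ℝ} (ht : t ∈ Ico 0 γ.period)
    (hu : u ∈ Ico 0 γ.period) (hne : t ≠ u) (h0 : γ.curve t = γ.curve u) (c : ℝ) :
    planeVelocity γ.curve t ≠ c • planeVelocity γ.curve u := by
  intro h1
  have hc0 : c ≠ 0 := by
    rintro rfl
    exact γ.planeVelocity_ne_zero t (by rw [h1, zero_smul])
  have h := γ.isGeodesic.eq_affine γ.isGeodesic h0 h1
  have hp : γ.period ≤ |c * γ.period| := by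
    refine γ.abs_period_le (mul_ne_zero hc0 γ.period_pos.ne') fun s => ?_
    have e1 := h (t + (s - u) / c + γ.period)
    have e2 := h (t + (s - u) / c)
    rw [γ.periodic, e2] at e1
    convert e1.symm using 2 <;> field_simp <;> ring
  have hp' : γ.period ≤ |γ.period / c| := by
    refine γ.abs_period_le (div_ne_zero γ.period_pos.ne' hc0) fun s => ?_
    rw [h, h s, ← γ.periodic (u + c * (s - t))]
    congr 1
    field_simp
    ring
  have hT := γ.period_pos
  have hca : |c| = 1 := by
    rw [abs_mul, abs_of_pos hT] at hp
    rw [abs_div, abs_of_pos hT, le_div_iff₀ (abs_pos.2 hc0)] at hp'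
    nlinarith
  rcases eq_or_eq_neg_of_abs_eq hca with rfl | rfl
  · have := γ.abs_period_le (sub_ne_zero.2 hne) fun s => by
      rw [h]
      congr 1
      ring
    have h' : |t - u| < γ.period := by rw [abs_lt]; constructor <;> linarith [ht.1, ht.2, hu.1, hu.2]
    linarith
  · have hd : HasDerivAt (fun s => u + -1 * (s - t)) (-1) ((t + u) / 2) := by
      simpa using (((hasDerivAt_id ((t + u) / 2)).sub_const t).const_mul (-1)).const_add u
    have h2 := planeVelocity_comp hd (γ.isGeodesic.mdifferentiableAt _)
    rw [← funext h, show u + -1 * ((t + u) / 2 - t) = (t + u) / 2 by ring, neg_smul, one_smul,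
      eq_neg_iff_add_eq_zero, ← two_smul ℝ, smul_eq_zero] at h2
    exact γ.planeVelocity_ne_zero _ (h2.resolve_left two_ne_zero)

end ClosedGeodesic

variable {n : ℕ} {γ : Fin n → ClosedGeodesic g}

/-- For passages of different geodesics, an affine reparametrization with nonzero factor would
identify the two images. -/
theorem planeVelocity_ne_smul_of_ne [T2Space M]
    (hdistinct : ∀ i j, i ≠ j → (γ i).image ≠ (γ j).image)
    {p : M} {q r : Fin n × ℝ} (hq : q ∈ passages γ p) (hr : r ∈ passages γ p) (hqr : q ≠ r)
    (c : ℝ) :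
    planeVelocity (γ q.1).curve q.2 ≠ c • planeVelocity (γ r.1).curve r.2 := by
  obtain ⟨i, t⟩ := q
  obtain ⟨j, u⟩ := r
  have h0 : (γ i).curve t = (γ j).curve u := hq.2.trans hr.2.symm
  by_cases hij : i = j
  · subst hij
    exact (γ i).linearIndependent_of_ne hq.1 hr.1 (fun h => hqr (Prod.ext rfl h)) h0 c
  · intro h1
    have hc0 : c ≠ 0 := by
      rintro rfl
      exact (γ i).planeVelocity_ne_zero t (by simpa using h1)
    have h := (γ i).isGeodesic.eq_affine (γ j).isGeodesic h0 h1
    refine hdistinct i j hij (Subset.antisymm ?_ ?_)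
    · rintro _ ⟨s, rfl⟩
      exact ⟨_, (h s).symm⟩
    · rintro _ ⟨s, rfl⟩
      refine ⟨t + (s - u) / c, ?_⟩
      rw [h]
      congr 1
      field_simp
      ring

theorem linearIndependent_planeVelocity [T2Space M]
    (hdistinct : ∀ i j, i ≠ j → (γ i).image ≠ (γ j).image)
    {p : M} {q r : Fin n × ℝ} (hq : q ∈ passages γ p) (hr : r ∈ passages γ p) (hqr : q ≠ r) :
    LinearIndependent ℝ ![planeVelocity (γ q.1).curve q.2, planeVelocity (γ r.1).curve r.2] := by
  rw [LinearIndependent.pair_iff' ((γ q.1).planeVelocity_ne_zero q.2)]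
  exact fun a h => planeVelocity_ne_smul_of_ne hdistinct hr hq hqr.symm a h.symm

end ClosedGeodesics

/-! ### Edge ends at a point of an embedded graph. -/

namespace EmbeddedGraph

variable {M : Type*} [TopologicalSpace M] (Γ : EmbeddedGraph M)

theorem eq_zero_or_eq_one_or_mem_Ioo (t : unitInterval) : t = 0 ∨ t = 1 ∨ t ∈ Ioo 0 1 := by
  by_cases h0 : t = 0
  · exact Or.inl h0
  by_cases h1 : t = 1
  · exact Or.inr (Or.inl h1)
  · exact Or.inr (Or.inr ⟨unitInterval.pos_iff_ne_zero.2 h0, unitInterval.lt_one_iff_ne_one.2 h1⟩)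

variable {Γ}

theorem mem_Ioo_of_edge_notMem {e : Fin Γ.numEdges} {t : unitInterval}
    (h : Γ.edge e t ∉ Γ.vertices) : t ∈ Ioo 0 1 := by
  rcases eq_zero_or_eq_one_or_mem_Ioo t with rfl | rfl | ht
  · exact absurd (Γ.source_mem e) h
  · exact absurd (Γ.target_mem e) h
  · exact ht

theorem edge_notMem_vertices {e : Fin Γ.numEdges} {t : unitInterval} (ht : t ∈ Ioo 0 1) :
    Γ.edge e t ∉ Γ.vertices :=
  disjoint_left.1 (Γ.interior_disjoint_vertices e) ⟨t, ht, rfl⟩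

theorem eq_of_edge_eq {e f : Fin Γ.numEdges} {t u : unitInterval}
    (h : Γ.edge e t = Γ.edge f u) (ht : Γ.edge e t ∉ Γ.vertices) : e = f ∧ t = u := by
  have h1 := mem_Ioo_of_edge_notMem ht
  have h2 := mem_Ioo_of_edge_notMem (h ▸ ht)
  have hef : e = f := by
    by_contra hne
    exact disjoint_left.1 (Γ.interior_disjoint e f hne) ⟨t, h1, rfl⟩ ⟨u, h2, h.symm⟩
  subst hef
  exact ⟨rfl, Γ.injOn e h1 h2 h⟩

theorem exists_edge_of_mem_support {p : M} (hp : p ∈ Γ.support) (hv : p ∉ Γ.vertices) :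
    ∃ e t, Γ.edge e t = p := by
  rcases hp with hp | hp
  · exact absurd hp hv
  · simpa using hp

variable [T2Space M]

/-- A connected subset of the graph without vertices is contained in an edge. -/
theorem exists_subset_range_edge {B : Set M} (hB : IsPreconnected B) (hne : B.Nonempty)
    (hsub : B ⊆ Γ.support \ Γ.vertices) : ∃ e, B ⊆ range (Γ.edge e) := by
  obtain ⟨x, hx⟩ := hne
  obtain ⟨e, t, rfl⟩ := exists_edge_of_mem_support (hsub hx).1 (hsub hx).2
  refine ⟨e, ?_⟩
  have hcl : ∀ f, IsClosed (range (Γ.edge f)) := fun f =>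
    (isCompact_range (Γ.edge f).continuous).isClosed
  by_contra hnot
  obtain ⟨y, hy, hye⟩ := not_subset.1 hnot
  -- The edge `e` and the union of the other edges are closed sets that meet only in vertices, so a
  -- connected set without vertices cannot meet both.
  have hcov : B ⊆ range (Γ.edge e) ∪ ⋃ f : {f // f ≠ e}, range (Γ.edge f) := by
    intro z hz
    obtain ⟨f, s, rfl⟩ := exists_edge_of_mem_support (hsub hz).1 (hsub hz).2
    by_cases hf : f = e
    · subst hf; exact Or.inl ⟨s, rfl⟩
    · exact Or.inr (mem_iUnion.2 ⟨⟨f, hf⟩, s, rfl⟩)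
  obtain ⟨z, hz, ⟨s, rfl⟩, hz2⟩ := isPreconnected_closed_iff.1 hB _ _ (hcl e)
    (isClosed_iUnion_of_finite fun f : {f // f ≠ e} => hcl f) hcov ⟨_, hx, t, rfl⟩
    ⟨y, hy, (hcov hy).resolve_left hye⟩
  obtain ⟨⟨f, hf⟩, u, hu⟩ := mem_iUnion.1 hz2
  exact hf (eq_of_edge_eq hu.symm (hsub hz).2).1.symm

/-- The set `B` contains the part of the edge `q.1` next to its point `q.2.1`, on the side given
by `q.2.2`. -/
def ContainsEnd (Γ : EmbeddedGraph M) (B : Set M) (q : Fin Γ.numEdges × unitInterval × Bool) :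
    Prop :=
  ∃ a, (q.2.2 = true ∧ q.2.1 < a ∧ Γ.edge q.1 '' Ioo q.2.1 a ⊆ B) ∨
    (q.2.2 = false ∧ a < q.2.1 ∧ Γ.edge q.1 '' Ioo a q.2.1 ⊆ B)

/-- Two intervals on the same side of the same parameter overlap. This makes the assignment of edge
ends to disjoint arcs injective. -/
theorem ContainsEnd.not_disjoint {B B' : Set M} {q : Fin Γ.numEdges × unitInterval × Bool}
    (h : Γ.ContainsEnd B q) (h' : Γ.ContainsEnd B' q) : ¬Disjoint B B' := by
  obtain ⟨e, t, b⟩ := q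
  obtain ⟨a, ⟨h1, h2, h3⟩ | ⟨h1, h2, h3⟩⟩ := h <;>
    obtain ⟨a', ⟨h1', h2', h3'⟩ | ⟨h1', h2', h3'⟩⟩ := h'
  · obtain ⟨x, hx, hx'⟩ := exists_between (lt_min h2 h2')
    exact not_disjoint_iff.2 ⟨_, h3 ⟨x, ⟨hx, hx'.trans_le (min_le_left _ _)⟩, rfl⟩,
      h3' ⟨x, ⟨hx, hx'.trans_le (min_le_right _ _)⟩, rfl⟩⟩
  · simp_all
  · simp_all
  · obtain ⟨x, hx, hx'⟩ := exists_between (max_lt h2 h2')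
    exact not_disjoint_iff.2 ⟨_, h3 ⟨x, ⟨(le_max_left _ _).trans_lt hx, hx'⟩, rfl⟩,
      h3' ⟨x, ⟨(le_max_right _ _).trans_lt hx, hx'⟩, rfl⟩⟩

/-- A connected subset of the graph without vertices contains one end of an edge at each point of
its frontier. -/
theorem exists_containsEnd {B : Set M} (hB : IsPreconnected B) (hsub : B ⊆ Γ.support \ Γ.vertices)
    {p : M} (hp : p ∉ B) (hcl : p ∈ closure B) :
    ∃ q : Fin Γ.numEdges × unitInterval × Bool, Γ.edge q.1 q.2.1 = p ∧ Γ.ContainsEnd B q := by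
  obtain ⟨e, he⟩ := exists_subset_range_edge hB (closure_nonempty_iff.1 ⟨p, hcl⟩) hsub
  set J : Set unitInterval := Γ.edge e ⁻¹' B with hJ
  have himg : ∀ u : Set unitInterval, IsClosed u → IsClosed (Γ.edge e '' u) := fun u hu =>
    (hu.isCompact.image (Γ.edge e).continuous).isClosed
  -- The edge is a closed map and is injective away from the vertices, so a closed separation of `J`
  -- would be carried to one of `B`.
  have hJc : IsPreconnected J := by
    refine isPreconnected_closed_iff.2 fun u v hu hv huv hJu hJv => ?_
    obtain ⟨x, hx, ⟨a, ha, rfl⟩, b, hb, hab⟩ := isPreconnected_closed_iff.1 hB _ _ (himg u hu)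
      (himg v hv) (fun x hx => by
        obtain ⟨t, rfl⟩ := he hx
        exact (huv hx).imp (fun h => ⟨t, h, rfl⟩) fun h => ⟨t, h, rfl⟩)
      (hJu.elim fun x hx => ⟨_, hx.1, x, hx.2, rfl⟩) (hJv.elim fun x hx => ⟨_, hx.1, x, hx.2, rfl⟩)
    obtain rfl := (eq_of_edge_eq hab.symm (hsub hx).2).2
    exact ⟨a, hx, ha, hb⟩
  obtain ⟨t, htJ, rfl⟩ : p ∈ Γ.edge e '' closure J := by
    refine closure_minimal (fun x hx => ?_) (himg _ isClosed_closure) hcl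
    obtain ⟨t, rfl⟩ := he hx
    exact ⟨t, subset_closure hx, rfl⟩
  have hord := hJc.ordConnected
  obtain ⟨a, ha⟩ : J.Nonempty := closure_nonempty_iff.1 ⟨t, htJ⟩
  -- The set `J` is order connected, accumulates at `t` and contains `a`, hence contains everything
  -- strictly between them. Equality is impossible since the point at `t` is not in `B`.
  rcases lt_trichotomy t a with hta | rfl | hta
  · refine ⟨(e, t, true), rfl, a, Or.inl ⟨rfl, hta, ?_⟩⟩
    rintro _ ⟨x, hx, rfl⟩
    obtain ⟨j, hj, hjJ⟩ := mem_closure_iff.1 htJ (Iio x) isOpen_Iio hx.1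
    exact hord.out hjJ ha ⟨le_of_lt hj, hx.2.le⟩
  · exact absurd ha hp
  · refine ⟨(e, t, false), rfl, a, Or.inr ⟨rfl, hta, ?_⟩⟩
    rintro _ ⟨x, hx, rfl⟩
    obtain ⟨j, hj, hjJ⟩ := mem_closure_iff.1 htJ (Ioi x) isOpen_Ioi hx.2
    exact hord.out ha hjJ ⟨hx.1.le, le_of_lt hj⟩

/-- The edge ends which may occur at `p`. -/
def endsAt (Γ : EmbeddedGraph M) (p : M) : Set (Fin Γ.numEdges × unitInterval × Bool) :=
  {q | Γ.edge q.1 q.2.1 = p ∧ (q.2.2 = true → q.2.1 ≠ 1) ∧ (q.2.2 = false → q.2.1 ≠ 0)}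

/-- An edge meets a vertex only at parameters 0 and 1, and each of these has only one side, so the
ends are exactly those counted by the degree. -/
theorem finite_endsAt_and_ncard_le_degree {p : M} (hp : p ∈ Γ.vertices) :
    (Γ.endsAt p).Finite ∧ (Γ.endsAt p).ncard ≤ Γ.degree p := by
  have hsub : Γ.endsAt p ⊆ (fun e => (e, (0 : unitInterval), true)) '' {e | Γ.edge e 0 = p} ∪
      (fun e => (e, (1 : unitInterval), false)) '' {e | Γ.edge e 1 = p} := by
    rintro ⟨e, t, b⟩ ⟨h1, h2, h3⟩
    simp only at h1 h2 h3
    rcases eq_zero_or_eq_one_or_mem_Ioo t with rfl | rfl | ht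
    · cases b
      · exact absurd rfl (h3 rfl)
      · exact Or.inl ⟨e, h1, rfl⟩
    · cases b
      · exact Or.inr ⟨e, h1, rfl⟩
      · exact absurd rfl (h2 rfl)
    · exact absurd (h1 ▸ hp) (edge_notMem_vertices ht)
  refine ⟨(toFinite _).subset hsub, (ncard_le_ncard hsub (toFinite _)).trans ?_⟩
  exact (ncard_union_le _ _).trans (add_le_add (ncard_image_le (toFinite _))
    (ncard_image_le (toFinite _)))

/-- Away from the vertices, the edge and the parameter are determined by the point; only the side
remains free. -/
theorem finite_endsAt_and_ncard_le_two {p : M} (hp : p ∉ Γ.vertices) :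
    (Γ.endsAt p).Finite ∧ (Γ.endsAt p).ncard ≤ 2 := by
  rcases (Γ.endsAt p).eq_empty_or_nonempty with h | ⟨⟨e, t, b⟩, hq⟩
  · simp [h]
  have hsub : Γ.endsAt p ⊆ {(e, t, true), (e, t, false)} := by
    rintro ⟨e', t', b'⟩ hq'
    obtain ⟨rfl, rfl⟩ := eq_of_edge_eq (hq.1.trans hq'.1.symm) (hq.1.symm ▸ hp)
    cases b' <;> simp
  exact ⟨(toFinite _).subset hsub, (ncard_le_ncard hsub (toFinite _)).trans ((ncard_insert_le _ _).trans (by simp))⟩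

/-- There are no more disjoint arcs starting at `p` than edge ends at `p`. -/
theorem card_le_ncard_endsAt {p : M} (hfin : (Γ.endsAt p).Finite) {ι : Type*} [Fintype ι]
    {B : ι → Set M} (hB : ∀ i, IsPreconnected (B i)) (hsub : ∀ i, B i ⊆ Γ.support \ Γ.vertices)
    (hp : ∀ i, p ∉ B i) (hcl : ∀ i, p ∈ closure (B i))
    (hdisj : Pairwise fun i j => Disjoint (B i) (B j)) :
    Fintype.card ι ≤ (Γ.endsAt p).ncard := by
  choose q hq hqB using fun i => exists_containsEnd (hB i) (hsub i) (hp i) (hcl i)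
  have hmem : ∀ i, q i ∈ Γ.endsAt p := by
    intro i
    refine ⟨hq i, fun h h1 => ?_, fun h h0 => ?_⟩
    · obtain ⟨a, ⟨-, h2, -⟩ | ⟨h2, -⟩⟩ := hqB i
      · exact absurd (h1 ▸ h2) (not_lt.2 unitInterval.le_one')
      · simp_all
    · obtain ⟨a, ⟨h2, -⟩ | ⟨-, h2, -⟩⟩ := hqB i
      · simp_all
      · exact absurd (h0 ▸ h2) (not_lt.2 unitInterval.nonneg')
  have hinj : Function.Injective q := by
    intro i j hij
    by_contra hne
    exact (hqB i).not_disjoint (hij ▸ hqB j) (hdisj hne)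
  rw [← Nat.card_eq_fintype_card, ← ncard_univ]
  exact ncard_le_ncard_of_injOn q (fun i _ => hmem i) hinj.injOn hfin

end EmbeddedGraph

/-! ### Charts in which given transversal curves are the axes. -/

/-- A smooth map of the plane with invertible derivative at a point is a diffeomorphism near this
point. -/
theorem exists_openPartialHomeomorph_of_contDiffOn {F : Plane → Plane} {U : Set Plane}
    (hU : IsOpen U) (hF : ContDiffOn ℝ ∞ F U) {z₀ : Plane} (hz₀ : z₀ ∈ U) {L : Plane ≃L[ℝ] Plane}
    (hL : HasFDerivAt F (L : Plane →L[ℝ] Plane) z₀) :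
    ∃ e : OpenPartialHomeomorph Plane Plane, z₀ ∈ e.source ∧ e.source ⊆ U ∧ (∀ z, e z = F z) ∧
      ContDiffOn ℝ ∞ e e.source ∧ ContDiffOn ℝ ∞ e.symm e.target := by
  have hat : ContDiffAt ℝ ∞ F z₀ := hF.contDiffAt (hU.mem_nhds hz₀)
  set e₀ := hat.toOpenPartialHomeomorph F hL (by simp) with he₀
  have hz₀' : z₀ ∈ e₀.source := hat.mem_toOpenPartialHomeomorph_source hL (by simp)
  have hcf : ContinuousOn (fderiv ℝ F) U := hF.continuousOn_fderiv_of_isOpen hU (by simp)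
  -- Restricting to the open set where the derivative is invertible makes the inverse smooth on the
  -- whole target, not only at the image of `z₀`.
  set V : Set Plane := U ∩ fderiv ℝ F ⁻¹' range ((↑) : (Plane ≃L[ℝ] Plane) → Plane →L[ℝ] Plane)
  have hV : IsOpen V := hcf.isOpen_inter_preimage hU ContinuousLinearEquiv.isOpen
  have hzV : z₀ ∈ V := ⟨hz₀, L, hL.fderiv.symm⟩
  refine ⟨e₀.restrOpen V hV, ⟨hz₀', hzV⟩, fun z hz => hz.2.1, fun z => rfl,
    fun z hz => (hF.contDiffAt (hU.mem_nhds hz.2.1)).contDiffWithinAt, fun y hy => ?_⟩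
  have hy' := (e₀.restrOpen V hV).map_target hy
  obtain ⟨L', hL'⟩ := hy'.2.2
  have hd : ContDiffAt ℝ ∞ F ((e₀.restrOpen V hV).symm y) := hF.contDiffAt (hU.mem_nhds hy'.2.1)
  refine ((e₀.restrOpen V hV).contDiffAt_symm hy (f₀' := L') ?_ hd).contDiffWithinAt
  rw [hL']
  exact (hd.differentiableAt (by simp)).hasFDerivAt

/-- The linear isomorphism of the plane given by a basis. -/
theorem exists_continuousLinearEquiv {v w : Plane} (h : LinearIndependent ℝ ![v, w]) :
    ∃ L : Plane ≃L[ℝ] Plane, ∀ z, L z = z 0 • v + z 1 • w := by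
  set l : Plane →ₗ[ℝ] Plane :=
    { toFun := fun z => z 0 • v + z 1 • w
      map_add' := fun z z' => by simp only [PiLp.add_apply, add_smul]; abel
      map_smul' := fun c z => by simp [mul_smul] }
  have hl : Function.Injective l := by
    rw [← LinearMap.ker_eq_bot, LinearMap.ker_eq_bot']
    intro z hz
    obtain ⟨h0, h1⟩ := LinearIndependent.pair_iff.1 h _ _ hz
    ext i
    fin_cases i
    exacts [h0, h1]
  exact ⟨(LinearEquiv.ofInjectiveEndo l hl).toContinuousLinearEquiv, fun z => rfl⟩

section Charts

variable {M : Type*} [TopologicalSpace M] [ChartedSpace Plane M] [IsManifold 𝓘(ℝ, Plane) ∞ M]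

theorem trans_symm_mem_maximalAtlas {φ : OpenPartialHomeomorph M Plane}
    (hφ : φ ∈ IsManifold.maximalAtlas 𝓘(ℝ, Plane) ∞ M) {e : OpenPartialHomeomorph Plane Plane}
    (he : ContDiffOn ℝ ∞ e e.source) (he' : ContDiffOn ℝ ∞ e.symm e.target) :
    φ.trans e.symm ∈ IsManifold.maximalAtlas 𝓘(ℝ, Plane) ∞ M := by
  refine OpenPartialHomeomorph.mem_maximalAtlas_of_contMDiffOn _ ?_ ?_
  · exact he'.contMDiffOn.comp ((contMDiffOn_of_mem_maximalAtlas hφ).mono fun x hx => hx.1)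
      fun x hx => hx.2
  · exact (contMDiffOn_symm_of_mem_maximalAtlas hφ).comp (he.contMDiffOn.mono fun x hx => hx.1)
      fun x hx => hx.2

/-- Two transversal curves through a point are the coordinate axes of a chart. -/
theorem exists_chart_of_linearIndependent {φ : OpenPartialHomeomorph M Plane}
    (hφ : φ ∈ IsManifold.maximalAtlas 𝓘(ℝ, Plane) ∞ M) {p : M} (hp : p ∈ φ.source)
    {a b : ℝ → Plane} {Ua Ub : Set ℝ} (hUa : IsOpen Ua) (hUb : IsOpen Ub) (h0a : 0 ∈ Ua)
    (h0b : 0 ∈ Ub) (ha : ContDiffOn ℝ ∞ a Ua) (hb : ContDiffOn ℝ ∞ b Ub) (ha0 : a 0 = φ p)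
    (hb0 : b 0 = φ p) (hab : LinearIndependent ℝ ![deriv a 0, deriv b 0]) :
    ∃ ψ ∈ IsManifold.maximalAtlas 𝓘(ℝ, Plane) ∞ M, (0 : Plane) ∈ ψ.target ∧
      ∀ z ∈ ψ.target, z 0 ∈ Ua ∧ z 1 ∈ Ub ∧ ψ.symm z = φ.symm (a (z 0) + b (z 1) - φ p) := by
  have hpr : ∀ i, ContDiff ℝ ∞ fun z : Plane => z i := fun i =>
    (EuclideanSpace.proj i : Plane →L[ℝ] ℝ).contDiff
  set U : Set Plane := {z | z 0 ∈ Ua} ∩ {z | z 1 ∈ Ub}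
  have hU : IsOpen U := (hUa.preimage (hpr 0).continuous).inter (hUb.preimage (hpr 1).continuous)
  -- This map sends the axes to the two curves, and the columns of its derivative at 0 are their
  -- velocities.
  set F : Plane → Plane := fun z => a (z 0) + b (z 1) - φ p
  have hF : ContDiffOn ℝ ∞ F U :=
    ((ha.comp (hpr 0).contDiffOn fun z hz => hz.1).add
      (hb.comp (hpr 1).contDiffOn fun z hz => hz.2)).sub contDiffOn_const
  obtain ⟨L, hL⟩ := exists_continuousLinearEquiv hab
  have hda : HasDerivAt a (deriv a 0) ((0 : Plane) 0) :=
    ((ha.contDiffAt (hUa.mem_nhds h0a)).differentiableAt (by simp)).hasDerivAt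
  have hdb : HasDerivAt b (deriv b 0) ((0 : Plane) 1) :=
    ((hb.contDiffAt (hUb.mem_nhds h0b)).differentiableAt (by simp)).hasDerivAt
  have hLF : HasFDerivAt F (L : Plane →L[ℝ] Plane) 0 := by
    have h1 := hda.hasFDerivAt.comp (0 : Plane)
      (EuclideanSpace.proj (0 : Fin 2) : Plane →L[ℝ] ℝ).hasFDerivAt
    have h2 := hdb.hasFDerivAt.comp (0 : Plane)
      (EuclideanSpace.proj (1 : Fin 2) : Plane →L[ℝ] ℝ).hasFDerivAt
    refine ((h1.add h2).sub_const (φ p)).congr_fderiv ?_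
    ext1 z
    simp [hL]
  obtain ⟨e, h0e, heU, heF, he, he'⟩ :=
    exists_openPartialHomeomorph_of_contDiffOn hU hF ⟨h0a, h0b⟩ hLF
  have hF0 : F 0 = φ p := by
    change a 0 + b 0 - φ p = φ p
    rw [ha0, hb0]
    abel
  refine ⟨φ.trans e.symm, trans_symm_mem_maximalAtlas hφ he he', ?_, fun z hz => ?_⟩
  · refine ⟨h0e, ?_⟩
    change e 0 ∈ φ.target
    rw [heF, hF0]
    exact φ.map_source hp
  · have hzU := heU hz.1
    exact ⟨hzU.1, hzU.2, congrArg φ.symm (heF z)⟩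

theorem exists_square_of_mem_nhds {V : Set Plane} (hV : V ∈ 𝓝 0) :
    ∃ ε > 0, ∀ z : Plane, |z 0| < ε → |z 1| < ε → z ∈ V := by
  obtain ⟨r, hr, hsub⟩ := Metric.mem_nhds_iff.1 hV
  refine ⟨r / 2, half_pos hr, fun z h0 h1 => hsub ?_⟩
  rw [mem_ball_zero_iff, EuclideanSpace.norm_eq, Real.sqrt_lt' hr]
  simp only [Fin.sum_univ_two, Real.norm_eq_abs]
  nlinarith [abs_nonneg (z 0), abs_nonneg (z 1)]

theorem isOpen_preimage_chart {γ : ℝ → M} (hγ : Continuous γ) (φ : OpenPartialHomeomorph M Plane)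
    (t : ℝ) : IsOpen {x | γ (t + x) ∈ φ.source} :=
  φ.open_source.preimage (hγ.comp (continuous_const_add t))

variable {g : SurfaceMetric M}

theorem IsGeodesic.contDiffOn_chart {γ : ℝ → M} (hγ : IsGeodesic g γ)
    {φ : OpenPartialHomeomorph M Plane} (hφ : φ ∈ IsManifold.maximalAtlas 𝓘(ℝ, Plane) ∞ M) (t : ℝ) :
    ContDiffOn ℝ ∞ (fun x => φ (γ (t + x))) {x | γ (t + x) ∈ φ.source} := fun x hx =>
  ((contDiffAt_chart hφ hγ.1 hx).comp x (contDiffAt_const.add contDiffAt_id)).contDiffWithinAt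

/-- The derivative of a chart, as a linear map of the plane. -/
noncomputable def chartDeriv (φ : OpenPartialHomeomorph M Plane) (p : M) : Plane →L[ℝ] Plane :=
  mfderiv 𝓘(ℝ, Plane) 𝓘(ℝ, Plane) φ p

/-- The derivative of the inverse of a chart, as a linear map of the plane. -/
noncomputable def chartSymmDeriv (φ : OpenPartialHomeomorph M Plane) (y : Plane) :
    Plane →L[ℝ] Plane :=
  mfderiv 𝓘(ℝ, Plane) 𝓘(ℝ, Plane) φ.symm y

theorem chartDeriv_chartSymmDeriv {φ : OpenPartialHomeomorph M Plane}
    (hφ : φ ∈ IsManifold.maximalAtlas 𝓘(ℝ, Plane) ∞ M) {y : Plane} (hy : y ∈ φ.target)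
    (v : Plane) : chartDeriv φ (φ.symm y) (chartSymmDeriv φ y v) = v :=
  mfderiv_symm_mfderiv hφ hy v

theorem chartSymmDeriv_chartDeriv {φ : OpenPartialHomeomorph M Plane}
    (hφ : φ ∈ IsManifold.maximalAtlas 𝓘(ℝ, Plane) ∞ M) {x : M} (hx : x ∈ φ.source)
    (v : Plane) : chartSymmDeriv φ (φ x) (chartDeriv φ x v) = v :=
  mfderiv_mfderiv_symm hφ hx v

theorem chartDeriv_injective {φ : OpenPartialHomeomorph M Plane}
    (hφ : φ ∈ IsManifold.maximalAtlas 𝓘(ℝ, Plane) ∞ M) {x : M} (hx : x ∈ φ.source) :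
    Function.Injective (chartDeriv φ x) :=
  Function.LeftInverse.injective (chartSymmDeriv_chartDeriv hφ hx)

theorem IsGeodesic.deriv_chart_add {γ : ℝ → M} (hγ : IsGeodesic g γ)
    {φ : OpenPartialHomeomorph M Plane} (hφ : φ ∈ IsManifold.maximalAtlas 𝓘(ℝ, Plane) ∞ M) {t : ℝ}
    (ht : γ t ∈ φ.source) :
    deriv (fun x => φ (γ (t + x))) 0 = chartDeriv φ (γ t) (planeVelocity γ t) := by
  have := deriv_comp_const_add (fun s => φ (γ s)) t 0
  rw [this, add_zero]
  exact deriv_chart hφ (hγ.mdifferentiableAt t) ht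

/-- Two geodesics crossing transversally are the coordinate axes of a chart. -/
theorem exists_crossing_chart {γ δ : ℝ → M} (hγ : IsGeodesic g γ) (hδ : IsGeodesic g δ) {t u : ℝ}
    (h0 : γ t = δ u) (hlin : LinearIndependent ℝ ![planeVelocity γ t, planeVelocity δ u]) :
    ∃ ψ ∈ IsManifold.maximalAtlas 𝓘(ℝ, Plane) ∞ M, ∃ ε > 0,
      (∀ z : Plane, |z 0| < ε → |z 1| < ε → z ∈ ψ.target) ∧
      (∀ x, |x| < ε → ψ.symm !₂[x, 0] = γ (t + x)) ∧
      (∀ y, |y| < ε → ψ.symm !₂[0, y] = δ (u + y)) := by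
  have hφ := IsManifold.chart_mem_maximalAtlas (I := 𝓘(ℝ, Plane)) (n := ∞) (γ t)
  have hp := mem_chart_source Plane (γ t)
  set φ := chartAt Plane (γ t)
  have hp' : δ u ∈ φ.source := by rw [← h0]; exact hp
  have hlin' : LinearIndependent ℝ
      ![deriv (fun x => φ (γ (t + x))) 0, deriv (fun x => φ (δ (u + x))) 0] := by
    rw [hγ.deriv_chart_add hφ hp, hδ.deriv_chart_add hφ hp', ← h0]
    rw [LinearIndependent.pair_iff] at hlin ⊢
    intro c d hcd
    refine hlin c d (chartDeriv_injective hφ hp ?_)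
    simpa using hcd
  obtain ⟨ψ, hψ, h0ψ, hψs⟩ := exists_chart_of_linearIndependent hφ hp
    (isOpen_preimage_chart hγ.continuous φ t) (isOpen_preimage_chart hδ.continuous φ u)
    (by simpa using hp) (by simpa using hp') (hγ.contDiffOn_chart hφ t) (hδ.contDiffOn_chart hφ u)
    (by simp) (by simp [h0]) hlin'
  obtain ⟨ε, hε, hsq⟩ := exists_square_of_mem_nhds (ψ.open_target.mem_nhds h0ψ)
  refine ⟨ψ, hψ, ε, hε, hsq, fun x hx => ?_, fun y hy => ?_⟩
  · obtain ⟨h1, h2, h3⟩ := hψs !₂[x, 0] (hsq _ (by simpa using hx) (by simpa using hε))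
    rw [h3]
    simpa [← h0] using φ.left_inv h1
  · obtain ⟨h1, h2, h3⟩ := hψs !₂[0, y] (hsq _ (by simpa using hε) (by simpa using hy))
    rw [h3]
    simpa using φ.left_inv h2

/-- A regular geodesic is a coordinate axis of a chart. -/
theorem exists_regular_chart {γ : ℝ → M} (hγ : IsGeodesic g γ) {t : ℝ}
    (hv : planeVelocity γ t ≠ 0) :
    ∃ ψ ∈ IsManifold.maximalAtlas 𝓘(ℝ, Plane) ∞ M, ∃ ε > 0,
      (∀ z : Plane, |z 0| < ε → |z 1| < ε → z ∈ ψ.target) ∧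
      (∀ x, |x| < ε → ψ.symm !₂[x, 0] = γ (t + x)) := by
  have hφ := IsManifold.chart_mem_maximalAtlas (I := 𝓘(ℝ, Plane)) (n := ∞) (γ t)
  have hp := mem_chart_source Plane (γ t)
  set φ := chartAt Plane (γ t)
  set v := deriv (fun x => φ (γ (t + x))) 0
  have hv' : v ≠ 0 := by
    rw [show v = _ from hγ.deriv_chart_add hφ hp]
    intro h
    exact hv (chartDeriv_injective hφ hp (h.trans (map_zero _).symm))
  -- The auxiliary second axis is the straight line in the direction of `v` turned by a right angle
  -- in coordinates; only transversality matters.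
  have hd : deriv (fun y : ℝ => φ (γ t) + y • (!₂[-v 1, v 0] : Plane)) 0 = !₂[-v 1, v 0] := by
    have := ((hasDerivAt_id (0 : ℝ)).smul_const (!₂[-v 1, v 0] : Plane)).const_add (φ (γ t))
    simpa using this.deriv
  have hlin : LinearIndependent ℝ ![v, (!₂[-v 1, v 0] : Plane)] := by
    rw [LinearIndependent.pair_iff' hv']
    intro a ha
    have h0 : a * v 0 = -v 1 := by simpa using congrArg (fun w : Plane => w 0) ha
    have h1 : a * v 1 = v 0 := by simpa using congrArg (fun w : Plane => w 1) ha
    have h2 : v 0 ^ 2 + v 1 ^ 2 = 0 := by linear_combination v 1 * h0 - v 0 * h1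
    refine hv' ?_
    ext i
    fin_cases i <;> simp <;> nlinarith [sq_nonneg (v 0), sq_nonneg (v 1)]
  obtain ⟨ψ, hψ, h0ψ, hψs⟩ := exists_chart_of_linearIndependent hφ hp
    (b := fun y : ℝ => φ (γ t) + y • (!₂[-v 1, v 0] : Plane))
    (isOpen_preimage_chart hγ.continuous φ t) isOpen_univ
    (by simpa using hp) (mem_univ _) (hγ.contDiffOn_chart hφ t) (by fun_prop)
    (by simp) (by simp) (by rw [hd]; exact hlin)
  obtain ⟨ε, hε, hsq⟩ := exists_square_of_mem_nhds (ψ.open_target.mem_nhds h0ψ)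
  refine ⟨ψ, hψ, ε, hε, hsq, fun x hx => ?_⟩
  obtain ⟨h1, h2, h3⟩ := hψs !₂[x, 0] (hsq _ (by simpa using hx) (by simpa using hε))
  rw [h3]
  simpa using φ.left_inv h1

end Charts

/-! ### The local branches at a point and the bound on passages. -/

section Passages

variable {M : Type*} [TopologicalSpace M] [ChartedSpace Plane M] [IsManifold 𝓘(ℝ, Plane) ∞ M]
  {g : SurfaceMetric M}

/-- The curve is an axis of a chart. The statement is in terms of all small `ε` so that a common one
can be chosen for finitely many passages. -/
theorem IsGeodesic.injOn_near {γ : ℝ → M} (hγ : IsGeodesic g γ) {t : ℝ}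
    (hv : planeVelocity γ t ≠ 0) :
    ∀ᶠ ε in 𝓝[>] (0 : ℝ), ∀ x y, |x| < ε → |y| < ε → γ (t + x) = γ (t + y) → x = y := by
  obtain ⟨ψ, hψ, ε, hε, hsq, hx⟩ := exists_regular_chart hγ hv
  filter_upwards [Ioo_mem_nhdsGT hε] with ε' hε' x y h1 h2 h
  have h1' := h1.trans hε'.2
  have h2' := h2.trans hε'.2
  rw [← hx x h1', ← hx y h2'] at h
  have := ψ.symm.injOn (hsq _ (by simpa using h1') (by simpa using hε))
    (hsq _ (by simpa using h2') (by simpa using hε)) h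
  simpa using congrArg (fun z : Plane => z 0) this

theorem IsGeodesic.eq_zero_of_crossing_near {γ δ : ℝ → M} (hγ : IsGeodesic g γ)
    (hδ : IsGeodesic g δ) {t u : ℝ} (h0 : γ t = δ u)
    (hlin : LinearIndependent ℝ ![planeVelocity γ t, planeVelocity δ u]) :
    ∀ᶠ ε in 𝓝[>] (0 : ℝ), ∀ x y, |x| < ε → |y| < ε → γ (t + x) = δ (u + y) → x = 0 ∧ y = 0 := by
  obtain ⟨ψ, hψ, ε, hε, hsq, hx, hy⟩ := exists_crossing_chart hγ hδ h0 hlin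
  filter_upwards [Ioo_mem_nhdsGT hε] with ε' hε' x y h1 h2 h
  have h1' := h1.trans hε'.2
  have h2' := h2.trans hε'.2
  rw [← hx x h1', ← hy y h2'] at h
  have := ψ.symm.injOn (hsq _ (by simpa using h1') (by simpa using hε))
    (hsq _ (by simpa using hε) (by simpa using h2')) h
  exact ⟨by simpa using congrArg (fun z : Plane => z 0) this,
    by simpa using (congrArg (fun z : Plane => z 1) this).symm⟩

variable [T2Space M] {n : ℕ} {γ : Fin n → ClosedGeodesic g}

/-- Near `p`, the union of the geodesics consists of short arcs of the passages through `p`. -/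
theorem exists_mem_nhds_passages (γ : Fin n → ClosedGeodesic g) (p : M) {δ : ℝ} (hδ : 0 < δ) :
    ∃ U ∈ 𝓝 p, ∀ x ∈ U, x ∈ (⋃ i, (γ i).image) →
      ∃ r ∈ passages γ p, ∃ s, |s| < δ ∧ x = (γ r.1).curve (r.2 + s) := by
  -- These are the times of one period at distance at least `δ` from every visit to `p`. Their
  -- images are compact and miss `p`, so the complement of the union is the required neighbourhood.
  set T : Fin n → Set ℝ := fun i =>
    Icc 0 (γ i).period \ ⋃ t ∈ {t | (γ i).curve t = p}, Metric.ball t δ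
  have hT : ∀ i, IsCompact ((γ i).curve '' T i) := fun i =>
    (isCompact_Icc.diff (isOpen_biUnion fun t _ => Metric.isOpen_ball)).image (γ i).continuous
  have hcl : IsClosed (⋃ i, (γ i).curve '' T i) := isClosed_iUnion_of_finite fun i => (hT i).isClosed
  refine ⟨(⋃ i, (γ i).curve '' T i)ᶜ, hcl.isOpen_compl.mem_nhds ?_, fun x hx hxK => ?_⟩
  · intro hp
    obtain ⟨i, t, ht, htp⟩ := mem_iUnion.1 hp
    exact ht.2 (mem_biUnion (show t ∈ {t | (γ i).curve t = p} from htp) (Metric.mem_ball_self hδ))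
  · obtain ⟨i, t, rfl⟩ := mem_iUnion.1 hxK
    obtain ⟨u, hu, hut⟩ := (γ i).periodic.exists_mem_Ico₀ (γ i).period_pos t
    rw [hut] at hx ⊢
    have hu' : u ∈ ⋃ t ∈ {t | (γ i).curve t = p}, Metric.ball t δ := by
      by_contra h
      exact hx (mem_iUnion.2 ⟨i, u, ⟨⟨hu.1, hu.2.le⟩, h⟩, rfl⟩)
    obtain ⟨v, hv, huv⟩ := mem_iUnion₂.1 hu'
    set T := (γ i).period
    have hT := (γ i).period_pos
    -- The visit `v` may lie outside the period interval; it is shifted back by whole periods, with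
    -- the offset `u - v` unchanged.
    refine ⟨(i, toIcoMod hT 0 v), ⟨by simpa using toIcoMod_mem_Ico hT 0 v, ?_⟩, u - v, huv, ?_⟩
    · change (γ i).curve (toIcoMod hT 0 v) = p
      rw [toIcoMod, (γ i).periodic.sub_zsmul_eq]
      exact hv
    · change _ = (γ i).curve (toIcoMod hT 0 v + (u - v))
      rw [toIcoMod, show v - toIcoDiv hT 0 v • T + (u - v) = u - toIcoDiv hT 0 v • T by ring,
        (γ i).periodic.sub_zsmul_eq]

theorem mem_closure_image_Ioo {f : ℝ → M} (hf : Continuous f) {ε : ℝ} (hε : 0 < ε) :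
    f 0 ∈ closure (f '' Ioo 0 ε) ∧ f 0 ∈ closure (f '' Ioo (-ε) 0) := by
  refine ⟨image_closure_subset_closure_image hf ⟨0, ?_, rfl⟩,
    image_closure_subset_closure_image hf ⟨0, ?_, rfl⟩⟩
  · rw [closure_Ioo hε.ne]; exact ⟨le_rfl, hε.le⟩
  · rw [closure_Ioo (by linarith)]; exact ⟨by linarith, le_rfl⟩

/-- The number of passages through a point is at most half the number of edge ends at it. -/
theorem two_mul_card_passages_le (hdistinct : ∀ i j, i ≠ j → (γ i).image ≠ (γ j).image)
    {Γ : EmbeddedGraph M} (hΓ : Γ.support = ⋃ i, (γ i).image) {p : M}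
    (hfin : (Γ.endsAt p).Finite) {P : Finset (Fin n × ℝ)} (hP : ∀ q ∈ P, q ∈ passages γ p) :
    2 * P.card ≤ (Γ.endsAt p).ncard := by
  -- One `ε` must serve all passages in `P`: the arcs are injective, different arcs meet only at
  -- `p`, and they contain no vertex except possibly `p`.
  have hinj : ∀ᶠ ε in 𝓝[>] (0 : ℝ), ∀ q ∈ P, ∀ x y, |x| < ε → |y| < ε →
      (γ q.1).curve (q.2 + x) = (γ q.1).curve (q.2 + y) → x = y :=
    (eventually_all_finset P).2 fun q _ =>
      (γ q.1).isGeodesic.injOn_near ((γ q.1).planeVelocity_ne_zero q.2)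
  have hcross : ∀ᶠ ε in 𝓝[>] (0 : ℝ), ∀ q ∈ P, ∀ r ∈ P, q ≠ r → ∀ x y, |x| < ε → |y| < ε →
      (γ q.1).curve (q.2 + x) = (γ r.1).curve (r.2 + y) → x = 0 ∧ y = 0 := by
    refine (eventually_all_finset P).2 fun q hq => (eventually_all_finset P).2 fun r hr => ?_
    by_cases hqr : q = r
    · exact Eventually.of_forall fun _ h => absurd hqr h
    · have := (γ q.1).isGeodesic.eq_zero_of_crossing_near (γ r.1).isGeodesic
        ((hP q hq).2.trans (hP r hr).2.symm)
        (linearIndependent_planeVelocity hdistinct (hP q hq) (hP r hr) hqr)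
      exact this.mono fun ε h _ => h
  have hvert : ∀ᶠ ε in 𝓝[>] (0 : ℝ), ∀ q ∈ P, ∀ x, |x| < ε →
      (γ q.1).curve (q.2 + x) ∉ Γ.vertices \ {p} := by
    refine (eventually_all_finset P).2 fun q hq => ?_
    have hc : Continuous fun x => (γ q.1).curve (q.2 + x) :=
      (γ q.1).continuous.comp (continuous_const_add _)
    have hcl : IsClosed (Γ.vertices \ {p}) := (Γ.finite_vertices.subset sdiff_subset).isClosed
    have h0 : (0 : ℝ) ∈ (fun x => (γ q.1).curve (q.2 + x)) ⁻¹' (Γ.vertices \ {p})ᶜ := by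
      simp [(hP q hq).2]
    obtain ⟨ε, hε, hsub⟩ := Metric.isOpen_iff.1 (hcl.isOpen_compl.preimage hc) 0 h0
    filter_upwards [Ioo_mem_nhdsGT hε] with ε' hε' x hx
    exact hsub (by simpa using hx.trans hε'.2)
  obtain ⟨ε, ⟨⟨hi, hc⟩, hv⟩, hε⟩ :=
    (((hinj.and hcross).and hvert).and self_mem_nhdsWithin).exists
  have hε : 0 < ε := hε
  set f : P → ℝ → M := fun q x => (γ q.1.1).curve (q.1.2 + x)
  have hf0 : ∀ q : P, f q 0 = p := fun q => by simpa [f] using (hP q q.2).2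
  have hfc : ∀ q : P, Continuous (f q) := fun q =>
    (γ q.1.1).continuous.comp (continuous_const_add _)
  have hfp : ∀ (q : P) x, |x| < ε → f q x = p → x = 0 := fun q x hx h =>
    hi q q.2 x 0 hx (by simpa using hε) (h.trans (hf0 q).symm)
  set I : Bool → Set ℝ := fun b => bif b then Ioo 0 ε else Ioo (-ε) 0 with hI
  have hIabs : ∀ b, ∀ x ∈ I b, |x| < ε ∧ x ≠ 0 := by
    intro b x hx
    cases b <;> simp only [hI, cond_true, cond_false, mem_Ioo] at hx
    · exact ⟨abs_lt.2 ⟨hx.1, by linarith⟩, hx.2.ne⟩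
    · exact ⟨abs_lt.2 ⟨by linarith, hx.2⟩, hx.1.ne'⟩
  -- The Boolean selects the half of the arc after or before `p`; this is the source of the factor
  -- 2.
  have hcard := EmbeddedGraph.card_le_ncard_endsAt hfin (ι := P × Bool)
    (B := fun q => f q.1 '' I q.2) ?_ ?_ ?_ ?_ ?_
  · simpa [mul_comm] using hcard
  · rintro ⟨q, b⟩
    refine IsPreconnected.image ?_ _ (hfc q).continuousOn
    cases b <;> exact isPreconnected_Ioo
  · rintro ⟨q, b⟩ _ ⟨x, hx, rfl⟩
    obtain ⟨h1, h2⟩ := hIabs b x hx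
    refine ⟨hΓ ▸ mem_iUnion.2 ⟨q.1.1, _, rfl⟩, fun hmem => ?_⟩
    exact hv q q.2 x h1 ⟨hmem, fun h => h2 (hfp q x h1 h)⟩
  · rintro ⟨q, b⟩ ⟨x, hx, hxp⟩
    obtain ⟨h1, h2⟩ := hIabs b x hx
    exact h2 (hfp q x h1 hxp)
  · rintro ⟨q, b⟩
    have := mem_closure_image_Ioo (hfc q) hε
    rw [hf0] at this
    cases b
    exacts [this.2, this.1]
  · rintro ⟨q, b⟩ ⟨r, c⟩ hne
    rw [disjoint_left]
    rintro _ ⟨x, hx, rfl⟩ ⟨y, hy, hxy⟩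
    obtain ⟨h1, h2⟩ := hIabs b x hx
    obtain ⟨h1', h2'⟩ := hIabs c y hy
    by_cases hqr : q = r
    · subst hqr
      obtain rfl := hi q q.2 y x h1' h1 hxy
      refine hne ?_
      have : b = c := by
        cases b <;> cases c <;> simp only [hI, cond_true, cond_false, mem_Ioo] at hx hy <;>
          first | rfl | linarith [hx.1, hx.2, hy.1, hy.2]
      rw [this]
    · exact h2 (hc q q.2 r r.2 (fun h => hqr (Subtype.ext h)) x y h1 h1' hxy.symm).1

end Passages

/-! ### Intersection points are double points; colours on the two sides of an edge. -/

section Atoms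

variable {M : Type*} [TopologicalSpace M] [ChartedSpace Plane M] [IsManifold 𝓘(ℝ, Plane) ∞ M]
  {g : SurfaceMetric M} [T2Space M] {n : ℕ} {γ : Fin n → ClosedGeodesic g}

/-- The passages are not yet known to be finite in number, so the bound is applied to a subset of k
+ 1 of them. -/
theorem passages_encard_le (hdistinct : ∀ i j, i ≠ j → (γ i).image ≠ (γ j).image)
    {Γ : EmbeddedGraph M} (hΓ : Γ.support = ⋃ i, (γ i).image) {p : M}
    (hfin : (Γ.endsAt p).Finite) {k : ℕ} (hk : (Γ.endsAt p).ncard < 2 * (k + 1)) :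
    (passages γ p).encard ≤ k := by
  by_contra h
  have h' : ((k + 1 : ℕ) : ℕ∞) ≤ (passages γ p).encard := by
    push_cast
    exact Order.add_one_le_of_lt (not_le.1 h)
  obtain ⟨t, ht, htc⟩ := exists_subset_encard_eq h'
  have htf : t.Finite := finite_of_encard_eq_coe htc
  have := two_mul_card_passages_le hdistinct hΓ hfin (P := htf.toFinset)
    fun q hq => ht (htf.mem_toFinset.1 hq)
  rw [htf.encard_eq_coe_toFinset_card] at htc
  have : htf.toFinset.card = k + 1 := by exact_mod_cast htc
  omega

/-- Elsewhere there are at most two edge ends, enough for a single passage only. -/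
theorem mem_vertices_of_isIntersectionPoint
    (hdistinct : ∀ i j, i ≠ j → (γ i).image ≠ (γ j).image)
    {Γ : EmbeddedGraph M} (hΓ : Γ.support = ⋃ i, (γ i).image) {p : M}
    (hp : IsIntersectionPoint γ p) : p ∈ Γ.vertices := by
  by_contra h
  obtain ⟨hfin, hcard⟩ := EmbeddedGraph.finite_endsAt_and_ncard_le_two h
  have := passages_encard_le hdistinct hΓ hfin (k := 1) (by omega)
  exact (not_subsingleton_iff.2 hp) (encard_le_one_iff_subsingleton.1 (by exact_mod_cast this))

theorem passages_encard_eq_two (hdistinct : ∀ i j, i ≠ j → (γ i).image ≠ (γ j).image)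
    {Γ : EmbeddedGraph M} (hΓ : Γ.support = ⋃ i, (γ i).image)
    (hdeg : ∀ v ∈ Γ.vertices, Γ.degree v = 4) {p : M}
    (hp : IsIntersectionPoint γ p) : (passages γ p).encard = 2 := by
  have hv := mem_vertices_of_isIntersectionPoint hdistinct hΓ hp
  obtain ⟨hfin, hcard⟩ := EmbeddedGraph.finite_endsAt_and_ncard_le_degree hv
  rw [hdeg p hv] at hcard
  refine le_antisymm ?_ ?_
  · exact_mod_cast passages_encard_le hdistinct hΓ hfin (k := 2) (by omega)
  · obtain ⟨q, hq, r, hr, hqr⟩ := hp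
    rw [← encard_pair hqr]
    exact encard_le_encard (insert_subset hq (singleton_subset_iff.2 hr))

theorem isSimpleIntersection (hdistinct : ∀ i j, i ≠ j → (γ i).image ≠ (γ j).image)
    {Γ : EmbeddedGraph M} (hΓ : Γ.support = ⋃ i, (γ i).image)
    (hdeg : ∀ v ∈ Γ.vertices, Γ.degree v = 4) {p : M}
    (hp : IsIntersectionPoint γ p) : IsSimpleIntersection γ p := by
  refine ⟨passages_encard_eq_two hdistinct hΓ hdeg hp, fun q r hq hr hqr => ?_⟩
  have h := linearIndependent_planeVelocity hdistinct hq hr hqr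
  rw [← velocityAt_eq hq.2, ← velocityAt_eq hr.2] at h
  exact h

/-! ### Colours of the complementary domains -/

/-- The colour of the cell containing a point of the complement of the graph. -/
def cellColor (color : Set M → Bool) (K : Set M) (x : M) : Bool :=
  color (connectedComponentIn Kᶜ x)

theorem cellColor_eq_of_isPreconnected {color : Set M → Bool} {K A : Set M} (hA : IsPreconnected A)
    (hAK : A ⊆ Kᶜ) {x y : M} (hx : x ∈ A) (hy : y ∈ A) : cellColor color K x = cellColor color K y :=
  congrArg color (connectedComponentIn_eq (hA.subset_connectedComponentIn hx hAK hy))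

/-- The edge through `x` lies in the closures of two cells of different colours. Both cells enter
`U`, hence meet `A` or `B`, so each of their colours is that of `A` or of `B`; these two cannot then
coincide. -/
theorem cellColor_ne_of_two_sides {Γ : EmbeddedGraph M} {color : Set M → Bool}
    (hcolor : ∀ e, ∃ C D : Set M, Γ.Incident e C ∧ Γ.Incident e D ∧ color C ≠ color D)
    {U A B : Set M} (hU : IsOpen U) (hA : IsPreconnected A) (hB : IsPreconnected B)
    (hAK : A ⊆ Γ.supportᶜ) (hBK : B ⊆ Γ.supportᶜ) (hUAB : U \ Γ.support ⊆ A ∪ B)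
    {x : M} (hx : x ∈ U) (hxK : x ∈ Γ.support) (hxv : x ∉ Γ.vertices) {a b : M} (ha : a ∈ A)
    (hb : b ∈ B) : cellColor color Γ.support a ≠ cellColor color Γ.support b := by
  obtain ⟨e, t, rfl⟩ := EmbeddedGraph.exists_edge_of_mem_support hxK hxv
  have ht := EmbeddedGraph.mem_Ioo_of_edge_notMem hxv
  have key : ∀ C, Γ.Incident e C → color C = cellColor color Γ.support a ∨
      color C = cellColor color Γ.support b := by
    rintro _ ⟨⟨c, hc, rfl⟩, hcl⟩
    obtain ⟨y, hyU, hy⟩ := mem_closure_iff.1 (hcl ⟨t, ht, rfl⟩) U hU hx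
    have hyK := connectedComponentIn_subset _ _ hy
    have hcy : color (connectedComponentIn Γ.supportᶜ c) = cellColor color Γ.support y :=
      congrArg color (connectedComponentIn_eq hy)
    rw [hcy]
    exact (hUAB ⟨hyU, hyK⟩).imp (fun h => cellColor_eq_of_isPreconnected hA hAK h ha)
      fun h => cellColor_eq_of_isPreconnected hB hBK h hb
  obtain ⟨C, D, hC, hD, hCD⟩ := hcolor e
  intro hab
  apply hCD
  rcases key C hC with h | h <;> rcases key D hD with h' | h' <;> simp_all

/-- A rectangle in the plane. -/
def rect (I J : Set ℝ) : Set Plane := {z | z 0 ∈ I ∧ z 1 ∈ J}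

theorem isOpen_rect {I J : Set ℝ} (hI : IsOpen I) (hJ : IsOpen J) : IsOpen (rect I J) :=
  (hI.preimage (by fun_prop : Continuous fun z : Plane => z 0)).inter
    (hJ.preimage (by fun_prop : Continuous fun z : Plane => z 1))

theorem isPreconnected_rect {I J : Set ℝ} (hI : Convex ℝ I) (hJ : Convex ℝ J) :
    IsPreconnected (rect I J) :=
  ((hI.linear_preimage (EuclideanSpace.proj (0 : Fin 2) : Plane →L[ℝ] ℝ).toLinearMap).inter
    (hJ.linear_preimage (EuclideanSpace.proj (1 : Fin 2) : Plane →L[ℝ] ℝ).toLinearMap)).isPreconnected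

theorem exists_notMem_vertices (Γ : EmbeddedGraph M) {f : ℝ → M} {a b : ℝ} (hab : a < b)
    (hf : InjOn f (Ioo a b)) : ∃ x ∈ Ioo a b, f x ∉ Γ.vertices := by
  obtain ⟨y, ⟨x, hx, rfl⟩, hy⟩ := ((Ioo_infinite hab).image hf).exists_notMem_finite
    Γ.finite_vertices
  exact ⟨x, hx, hy⟩

variable {ψ : OpenPartialHomeomorph M Plane} {ε : ℝ}

theorem cellColor_eq_of_rect {color : Set M → Bool} {K : Set M} {I J : Set ℝ} (hI : Convex ℝ I)
    (hJ : Convex ℝ J) (hsub : rect I J ⊆ ψ.target) (hK : ∀ z ∈ rect I J, ψ.symm z ∉ K)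
    {z w : Plane} (hz : z ∈ rect I J) (hw : w ∈ rect I J) :
    cellColor color K (ψ.symm z) = cellColor color K (ψ.symm w) :=
  cellColor_eq_of_isPreconnected
    ((isPreconnected_rect hI hJ).image _ (ψ.continuousOn_symm.mono hsub))
    (by rintro _ ⟨z, hz, rfl⟩; exact hK z hz) ⟨z, hz, rfl⟩ ⟨w, hw, rfl⟩

/-- The injective path `f` runs in the graph between the rectangles. As the vertices are finite in
number, some point of it lies inside an edge. -/
theorem cellColor_ne_of_rect {Γ : EmbeddedGraph M} {color : Set M → Bool}
    (hcolor : ∀ e, ∃ C D : Set M, Γ.Incident e C ∧ Γ.Incident e D ∧ color C ≠ color D)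
    {W : Set Plane} (hW : IsOpen W) (hWt : W ⊆ ψ.target) {I J I' J' : Set ℝ} (hI : Convex ℝ I)
    (hJ : Convex ℝ J) (hI' : Convex ℝ I') (hJ' : Convex ℝ J') (hsub : rect I J ⊆ W)
    (hsub' : rect I' J' ⊆ W) (hK : ∀ z ∈ rect I J, ψ.symm z ∉ Γ.support)
    (hK' : ∀ z ∈ rect I' J', ψ.symm z ∉ Γ.support)
    (hcov : ∀ z ∈ W, ψ.symm z ∉ Γ.support → z ∈ rect I J ∪ rect I' J')
    {f : ℝ → Plane} (hfinj : Function.Injective f) {a b : ℝ} (hab : a < b)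
    (hf : ∀ x ∈ Ioo a b, f x ∈ W ∧ ψ.symm (f x) ∈ Γ.support)
    {z w : Plane} (hz : z ∈ rect I J) (hw : w ∈ rect I' J') :
    cellColor color Γ.support (ψ.symm z) ≠ cellColor color Γ.support (ψ.symm w) := by
  obtain ⟨x, hx, hxv⟩ := exists_notMem_vertices Γ hab (f := fun x => ψ.symm (f x))
    fun x hx y hy hxy => hfinj (ψ.symm.injOn (hWt (hf x hx).1) (hWt (hf y hy).1) hxy)
  refine cellColor_ne_of_two_sides hcolor (U := ψ.symm '' W)
    (ψ.isOpen_image_symm_of_subset_target hW hWt)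
    ((isPreconnected_rect hI hJ).image _ (ψ.continuousOn_symm.mono (hsub.trans hWt)))
    ((isPreconnected_rect hI' hJ').image _ (ψ.continuousOn_symm.mono (hsub'.trans hWt)))
    (by rintro _ ⟨z, hz, rfl⟩; exact hK z hz) (by rintro _ ⟨z, hz, rfl⟩; exact hK' z hz)
    ?_ ⟨f x, (hf x hx).1, rfl⟩ (hf x hx).2 hxv ⟨z, hz, rfl⟩ ⟨w, hw, rfl⟩
  rintro _ ⟨⟨z, hz, rfl⟩, hzK⟩
  exact (hcov z hz hzK).imp (fun h => ⟨z, h, rfl⟩) fun h => ⟨z, h, rfl⟩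

end Atoms

/-! ### Charts adapted to a geodesic and to the colouring. -/

section Boxes

variable {M : Type*} [TopologicalSpace M] [ChartedSpace Plane M] [IsManifold 𝓘(ℝ, Plane) ∞ M]
  {g : SurfaceMetric M} [T2Space M] {n : ℕ} {γ : Fin n → ClosedGeodesic g}

/-- A chart around the point `c t` in which the curve `c` is the first coordinate axis, together
with the colours `d true` and `d false` of its upper right and upper left quadrants; the lower
quadrants have the opposite colours. -/
structure IsColoredChart (col : M → Bool) (c : ℝ → M) (t : ℝ) (ψ : OpenPartialHomeomorph M Plane)
    (ε : ℝ) (d : Bool → Bool) : Prop where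
  mem_maximalAtlas : ψ ∈ IsManifold.maximalAtlas 𝓘(ℝ, Plane) ∞ M
  pos : 0 < ε
  mem_target : ∀ z : Plane, |z 0| < ε → |z 1| < ε → z ∈ ψ.target
  axis : ∀ x, |x| < ε → ψ.symm !₂[x, 0] = c (t + x)
  upper : ∀ z : Plane, |z 0| < ε → |z 1| < ε → z 0 ≠ 0 → 0 < z 1 →
    col (ψ.symm z) = d (decide (0 < z 0))
  lower : ∀ z : Plane, |z 0| < ε → |z 1| < ε → z 0 ≠ 0 → z 1 < 0 →
    col (ψ.symm z) = !d (decide (0 < z 0))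

theorem eq_mk_of_snd_eq_zero {z : Plane} (h : z 1 = 0) : z = !₂[z 0, 0] := by
  ext i; fin_cases i <;> simp [h]

theorem eq_mk_of_fst_eq_zero {z : Plane} (h : z 0 = 0) : z = !₂[0, z 1] := by
  ext i; fin_cases i <;> simp [h]

/-- The right or left half of an interval around `0`. -/
def halfInterval (ε : ℝ) (b : Bool) : Set ℝ := bif b then Ioo 0 ε else Ioo (-ε) 0

theorem mem_halfInterval {ε x : ℝ} (hx : |x| < ε) (h0 : x ≠ 0) :
    x ∈ halfInterval ε (decide (0 < x)) := by
  rw [abs_lt] at hx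
  rcases lt_or_gt_of_ne h0 with h | h
  · simp [halfInterval, not_lt.2 h.le, hx.1, h]
  · simp [halfInterval, h, hx.2]

theorem halfInterval_subset {ε x : ℝ} {b : Bool} (hx : x ∈ halfInterval ε b) :
    |x| < ε ∧ x ≠ 0 := by
  cases b <;> simp only [halfInterval, cond_true, cond_false, mem_Ioo] at hx
  · exact ⟨abs_lt.2 ⟨hx.1, by linarith⟩, hx.2.ne⟩
  · exact ⟨abs_lt.2 ⟨by linarith, hx.2⟩, hx.1.ne'⟩

theorem convex_halfInterval (ε : ℝ) (b : Bool) : Convex ℝ (halfInterval ε b) := by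
  cases b <;> exact convex_Ioo _ _

theorem isOpen_halfInterval (ε : ℝ) (b : Bool) : IsOpen (halfInterval ε b) := by
  cases b <;> exact isOpen_Ioo

variable {Γ : EmbeddedGraph M} {color : Set M → Bool} {ψ : OpenPartialHomeomorph M Plane} {ε : ℝ}

/-- The representative point of the upper quadrant. -/
noncomputable def quadrantPoint (ε : ℝ) (b : Bool) : Plane := !₂[bif b then ε / 2 else -(ε / 2), ε / 2]

theorem quadrantPoint_mem (hε : 0 < ε) (b : Bool) :
    quadrantPoint ε b ∈ rect (halfInterval ε b) (Ioo 0 ε) := by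
  cases b <;> simp [quadrantPoint, rect, halfInterval] <;> linarith

/-- The graph is described only off the second axis, so that the lemma covers regular points and
crossings alike. Each half of the first axis separates an upper from a lower quadrant. -/
theorem isColoredChart_of_mem_support_iff
    (hcolor : ∀ e, ∃ C D : Set M, Γ.Incident e C ∧ Γ.Incident e D ∧ color C ≠ color D)
    {c : ℝ → M} {t : ℝ} (hψ : ψ ∈ IsManifold.maximalAtlas 𝓘(ℝ, Plane) ∞ M) (hε : 0 < ε)
    (hsq : ∀ z : Plane, |z 0| < ε → |z 1| < ε → z ∈ ψ.target)
    (hax : ∀ x, |x| < ε → ψ.symm !₂[x, 0] = c (t + x))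
    (hK : ∀ z : Plane, |z 0| < ε → |z 1| < ε → z 0 ≠ 0 → (ψ.symm z ∈ Γ.support ↔ z 1 = 0)) :
    IsColoredChart (cellColor color Γ.support) c t ψ ε
      fun b => cellColor color Γ.support (ψ.symm (quadrantPoint ε b)) := by
  have habs : ∀ {x : ℝ}, x ∈ Ioo 0 ε → |x| < ε := fun {x} hx => abs_lt.2 ⟨by linarith [hx.1], hx.2⟩
  have habs' : ∀ {x : ℝ}, x ∈ Ioo (-ε) 0 → |x| < ε :=
    fun {x} hx => abs_lt.2 ⟨hx.1, by linarith [hx.2]⟩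
  have hmem : ∀ z : Plane, |z 0| < ε → |z 1| < ε → z 0 ≠ 0 → 0 < z 1 →
      z ∈ rect (halfInterval ε (decide (0 < z 0))) (Ioo 0 ε) :=
    fun z h0 h1 hz hz1 => ⟨mem_halfInterval h0 hz, hz1, (abs_lt.1 h1).2⟩
  have hup : ∀ b, ∀ z ∈ rect (halfInterval ε b) (Ioo 0 ε), ψ.symm z ∉ Γ.support := by
    intro b z hz h
    obtain ⟨h0, h0'⟩ := halfInterval_subset hz.1
    exact hz.2.1.ne' ((hK z h0 (habs hz.2) h0').1 h)
  have hlow : ∀ b, ∀ z ∈ rect (halfInterval ε b) (Ioo (-ε) 0), ψ.symm z ∉ Γ.support := by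
    intro b z hz h
    obtain ⟨h0, h0'⟩ := halfInterval_subset hz.1
    exact hz.2.2.ne ((hK z h0 (habs' hz.2) h0').1 h)
  refine ⟨hψ, hε, hsq, hax, fun z h0 h1 hz hz1 => ?_, fun z h0 h1 hz hz1 => ?_⟩
  · refine cellColor_eq_of_rect (convex_halfInterval ε _) (convex_Ioo 0 ε) ?_ (hup _)
      (hmem z h0 h1 hz hz1) (quadrantPoint_mem hε _)
    exact fun w hw => hsq w (halfInterval_subset hw.1).1 (habs hw.2)
  · rw [Bool.eq_not]
    set b := decide (0 < z 0)
    have hb : ∃ a a', a < a' ∧ halfInterval ε b = Ioo a a' := by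
      cases b
      exacts [⟨-ε, 0, by linarith, rfl⟩, ⟨0, ε, hε, rfl⟩]
    obtain ⟨a, a', haa, hI⟩ := hb
    refine (cellColor_ne_of_rect hcolor (W := rect (halfInterval ε b) (Ioo (-ε) ε))
      (isOpen_rect (isOpen_halfInterval ε b) isOpen_Ioo)
      (fun w hw => hsq w (halfInterval_subset hw.1).1 (abs_lt.2 hw.2))
      (convex_halfInterval ε b) (convex_Ioo 0 ε) (convex_halfInterval ε b) (convex_Ioo (-ε) 0)
      (fun w hw => ⟨hw.1, by linarith [hw.2.1], hw.2.2⟩)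
      (fun w hw => ⟨hw.1, hw.2.1, by linarith [hw.2.2]⟩) (hup b) (hlow b) (fun w hw hwK => ?_)
      (f := fun x => !₂[x, 0]) (fun x y hxy => by simpa using congrArg (fun z : Plane => z 0) hxy)
      haa (fun x hx => ?_) (quadrantPoint_mem hε b) ⟨mem_halfInterval h0 hz,
        (abs_lt.1 h1).1, hz1⟩).symm
    · obtain ⟨k0, k0'⟩ := halfInterval_subset hw.1
      have h1 : w 1 ≠ 0 := fun h => hwK ((hK w k0 (abs_lt.2 hw.2) k0').2 h)
      rcases lt_or_gt_of_ne h1 with h | h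
      · exact Or.inr ⟨hw.1, hw.2.1, h⟩
      · exact Or.inl ⟨hw.1, h, hw.2.2⟩
    · rw [← hI] at hx
      obtain ⟨k0, k0'⟩ := halfInterval_subset hx
      refine ⟨⟨by simpa using hx, by simpa using hε⟩, ?_⟩
      exact (hK !₂[x, 0] (by simpa using k0) (by simpa using hε) (by simpa using k0')).2 (by simp)

theorem exists_square_image {ψ : OpenPartialHomeomorph M Plane} {ε : ℝ} (hε : 0 < ε)
    (hsq : ∀ z : Plane, |z 0| < ε → |z 1| < ε → z ∈ ψ.target) {U : Set M}
    (hU : U ∈ 𝓝 (ψ.symm 0)) :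
    ∃ ε' > 0, ε' ≤ ε ∧ ∀ z : Plane, |z 0| < ε' → |z 1| < ε' → ψ.symm z ∈ U := by
  have h0 : (0 : Plane) ∈ ψ.target := hsq 0 (by simpa using hε) (by simpa using hε)
  obtain ⟨r, hr, hsub⟩ := exists_square_of_mem_nhds
    ((ψ.continuousAt_symm h0).preimage_mem_nhds hU)
  exact ⟨min r ε, lt_min hr hε, min_le_right _ _, fun z hz hz' =>
    hsub z (hz.trans_le (min_le_left _ _)) (hz'.trans_le (min_le_left _ _))⟩

theorem exists_passage (γ : Fin n → ClosedGeodesic g) (i : Fin n) (t : ℝ) :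
    ∃ t₀, (i, t₀) ∈ passages γ ((γ i).curve t) ∧
      ∀ s, (γ i).curve (t₀ + s) = (γ i).curve (t + s) := by
  have hT := (γ i).period_pos
  have h : ∀ s, (γ i).curve (toIcoMod hT 0 t + s) = (γ i).curve (t + s) := fun s => by
    rw [toIcoMod, show t - toIcoDiv hT 0 t • (γ i).period + s
      = t + s - toIcoDiv hT 0 t • (γ i).period by ring, (γ i).periodic.sub_zsmul_eq]
  exact ⟨toIcoMod hT 0 t, ⟨by simpa using toIcoMod_mem_Ico hT 0 t, by simpa using h 0⟩, h⟩

/-- At an intersection point the graph is the union of both axes, and the positive second half-axis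
separates the upper quadrants. Otherwise it is the first axis alone, and the whole upper half lies
in one cell. -/
theorem exists_isColoredChart (hdistinct : ∀ i j, i ≠ j → (γ i).image ≠ (γ j).image)
    (hΓ : Γ.support = ⋃ i, (γ i).image) (hdeg : ∀ v ∈ Γ.vertices, Γ.degree v = 4)
    (hcolor : ∀ e, ∃ C D : Set M, Γ.Incident e C ∧ Γ.Incident e D ∧ color C ≠ color D)
    (i : Fin n) (t : ℝ) :
    ∃ ψ ε d, IsColoredChart (cellColor color Γ.support) (γ i).curve t ψ ε d ∧
      (d true ≠ d false ↔ IsIntersectionPoint γ ((γ i).curve t)) := by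
  obtain ⟨t₀, hq, ht₀⟩ := exists_passage γ i t
  have hv := (γ i).planeVelocity_ne_zero t₀
  have hcurve : ∀ x, (γ i).curve x ∈ Γ.support := fun x => hΓ ▸ mem_iUnion.2 ⟨i, x, rfl⟩
  by_cases hp : IsIntersectionPoint γ ((γ i).curve t)
  · obtain ⟨r, hr, hrq⟩ := hp.exists_ne (i, t₀)
    have hqr : ∀ s ∈ passages γ ((γ i).curve t), s = (i, t₀) ∨ s = r := by
      obtain ⟨x, y, hxy, hxy'⟩ := encard_eq_two.1 (passages_encard_eq_two hdistinct hΓ hdeg hp)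
      rw [hxy'] at hq hr ⊢
      intro s hs
      simp only [mem_insert_iff, mem_singleton_iff] at hq hr hs
      grind
    have hlin : LinearIndependent ℝ ![planeVelocity (γ i).curve t₀, planeVelocity (γ r.1).curve r.2] :=
      linearIndependent_planeVelocity (q := (i, t₀)) hdistinct hq hr hrq.symm
    have hqr0 : (γ i).curve t₀ = (γ r.1).curve r.2 := hq.2.trans hr.2.symm
    obtain ⟨ψ, hψ, ε₀, hε₀, hsq, hax, hay⟩ := exists_crossing_chart (γ i).isGeodesic
      (γ r.1).isGeodesic hqr0 hlin
    obtain ⟨U, hU, hUK⟩ := exists_mem_nhds_passages γ ((γ i).curve t) hε₀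
    have h00 : ψ.symm 0 = (γ i).curve t := by
      have := hax 0 (by simpa using hε₀)
      rw [ht₀, add_zero] at this
      rw [← this]
      congr 1
      ext k; fin_cases k <;> simp
    obtain ⟨ε, hε, hle, himg⟩ := exists_square_image hε₀ hsq (h00 ▸ hU)
    have hsq' : ∀ z : Plane, |z 0| < ε → |z 1| < ε → z ∈ ψ.target :=
      fun z h h' => hsq z (h.trans_le hle) (h'.trans_le hle)
    -- The neighbourhood `U` contains no part of the graph other than short arcs of the two
    -- passages, and these are the axes.
    have hK : ∀ z : Plane, |z 0| < ε → |z 1| < ε → (ψ.symm z ∈ Γ.support ↔ z 0 = 0 ∨ z 1 = 0) := by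
      intro z h0 h1
      constructor
      · intro hz
        obtain ⟨s, hs, x, hx, hzx⟩ := hUK _ (himg z h0 h1) (hΓ ▸ hz)
        rcases hqr s hs with rfl | rfl
        · right
          rw [← hax x hx] at hzx
          have := ψ.symm.injOn (hsq' z h0 h1) (hsq _ (by simpa using hx) (by simpa using hε₀)) hzx
          simp [this]
        · left
          rw [← hay x hx] at hzx
          have := ψ.symm.injOn (hsq' z h0 h1) (hsq _ (by simpa using hε₀) (by simpa using hx)) hzx
          simp [this]
      · rintro (h | h)
        · rw [eq_mk_of_fst_eq_zero h, hay _ (h1.trans_le hle)]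
          exact hΓ ▸ mem_iUnion.2 ⟨r.1, _, rfl⟩
        · rw [eq_mk_of_snd_eq_zero h, hax _ (h0.trans_le hle)]
          exact hcurve _
    refine ⟨ψ, ε, _, isColoredChart_of_mem_support_iff hcolor hψ hε hsq'
      (fun x hx => (hax x (hx.trans_le hle)).trans (ht₀ x))
      (fun z h0 h1 hz => (hK z h0 h1).trans (by simp [hz])), iff_of_true ?_ hp⟩
    have habs : ∀ {x : ℝ}, x ∈ Ioo 0 ε → |x| < ε :=
      fun {x} hx => abs_lt.2 ⟨by linarith [hx.1], hx.2⟩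
    have hup : ∀ b, ∀ z ∈ rect (halfInterval ε b) (Ioo 0 ε), ψ.symm z ∉ Γ.support := by
      intro b z hz h
      obtain ⟨h0, h0'⟩ := halfInterval_subset hz.1
      exact ((hK z h0 (habs hz.2)).1 h).elim h0' hz.2.1.ne'
    refine cellColor_ne_of_rect hcolor (W := rect (Ioo (-ε) ε) (Ioo 0 ε))
      (isOpen_rect isOpen_Ioo isOpen_Ioo) (fun w hw => hsq' w (abs_lt.2 hw.1) (habs hw.2))
      (convex_halfInterval ε true) (convex_Ioo 0 ε) (convex_halfInterval ε false) (convex_Ioo 0 ε)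
      (fun w hw => ⟨abs_lt.1 (halfInterval_subset hw.1).1, hw.2⟩)
      (fun w hw => ⟨abs_lt.1 (halfInterval_subset hw.1).1, hw.2⟩) (hup true) (hup false)
      (fun w hw hwK => ?_) (f := fun y => !₂[0, y])
      (fun x y hxy => by simpa using congrArg (fun z : Plane => z 1) hxy) hε (fun y hy => ?_)
      (quadrantPoint_mem hε true) (quadrantPoint_mem hε false)
    · have h0 : w 0 ≠ 0 := fun h => hwK ((hK w (abs_lt.2 hw.1) (habs hw.2)).2 (Or.inl h))
      rcases lt_or_gt_of_ne h0 with h | h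
      · exact Or.inr ⟨⟨hw.1.1, h⟩, hw.2⟩
      · exact Or.inl ⟨⟨h, hw.1.2⟩, hw.2⟩
    · refine ⟨⟨by simpa using hε, by simpa using hy⟩, ?_⟩
      exact (hK !₂[0, y] (by simpa using hε) (by simpa using habs hy)).2 (by simp)
  · have hqr : ∀ s ∈ passages γ ((γ i).curve t), s = (i, t₀) :=
      fun s hs => not_nontrivial_iff.1 hp hs hq
    obtain ⟨ψ, hψ, ε₀, hε₀, hsq, hax⟩ := exists_regular_chart (γ i).isGeodesic hv
    obtain ⟨U, hU, hUK⟩ := exists_mem_nhds_passages γ ((γ i).curve t) hε₀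
    have h00 : ψ.symm 0 = (γ i).curve t := by
      have := hax 0 (by simpa using hε₀)
      rw [ht₀, add_zero] at this
      rw [← this]
      congr 1
      ext k; fin_cases k <;> simp
    obtain ⟨ε, hε, hle, himg⟩ := exists_square_image hε₀ hsq (h00 ▸ hU)
    have hsq' : ∀ z : Plane, |z 0| < ε → |z 1| < ε → z ∈ ψ.target :=
      fun z h h' => hsq z (h.trans_le hle) (h'.trans_le hle)
    have hK : ∀ z : Plane, |z 0| < ε → |z 1| < ε → (ψ.symm z ∈ Γ.support ↔ z 1 = 0) := by
      intro z h0 h1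
      constructor
      · intro hz
        obtain ⟨s, hs, x, hx, hzx⟩ := hUK _ (himg z h0 h1) (hΓ ▸ hz)
        obtain rfl := hqr s hs
        rw [← hax x hx] at hzx
        have := ψ.symm.injOn (hsq' z h0 h1) (hsq _ (by simpa using hx) (by simpa using hε₀)) hzx
        simp [this]
      · intro h
        rw [eq_mk_of_snd_eq_zero h, hax _ (h0.trans_le hle)]
        exact hcurve _
    refine ⟨ψ, ε, _, isColoredChart_of_mem_support_iff hcolor hψ hε hsq'
      (fun x hx => (hax x (hx.trans_le hle)).trans (ht₀ x))
      (fun z h0 h1 _ => hK z h0 h1), iff_of_false ?_ hp⟩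
    rw [not_not]
    have habs : ∀ {x : ℝ}, x ∈ Ioo 0 ε → |x| < ε :=
      fun {x} hx => abs_lt.2 ⟨by linarith [hx.1], hx.2⟩
    refine cellColor_eq_of_rect (convex_Ioo (-ε) ε) (convex_Ioo 0 ε)
      (fun w hw => hsq' w (abs_lt.2 hw.1) (habs hw.2))
      (fun w hw h => hw.2.1.ne' ((hK w (abs_lt.2 hw.1) (habs hw.2)).1 h)) ?_ ?_
    · exact ⟨abs_lt.1 (halfInterval_subset (quadrantPoint_mem hε true).1).1,
        (quadrantPoint_mem hε true).2⟩
    · exact ⟨abs_lt.1 (halfInterval_subset (quadrantPoint_mem hε false).1).1,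
        (quadrantPoint_mem hε false).2⟩

end Boxes

/-! ### The colour on the side to which a vector points. -/

section Sides

variable {M : Type*} [TopologicalSpace M] [ChartedSpace Plane M] [IsManifold 𝓘(ℝ, Plane) ∞ M]

/-- The curve which starts at `p` in the direction `w` and is straight in the preferred chart. -/
noncomputable def chartRay (p : M) (w : Plane) (u : ℝ) : M :=
  (chartAt Plane p).symm (chartAt Plane p p + u • chartDeriv (chartAt Plane p) p w)

/-- For a curve with velocity `e` at `p`, the points next to `p`, slightly later than `p` and on the
side of the vector `v`, have the colour `true`. -/
def RightColor (col : M → Bool) (p : M) (e v : Plane) : Prop :=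
  ∀ᶠ κ in 𝓝[>] (0 : ℝ), ∀ᶠ u in 𝓝[>] (0 : ℝ), col (chartRay p (e + κ • v) u) = true

theorem chartRay_zero (p : M) (w : Plane) : chartRay p w 0 = p := by
  simp [chartRay, (chartAt Plane p).left_inv (mem_chart_source Plane p)]

theorem continuousAt_chartRay (p : M) (w : Plane) : ContinuousAt (chartRay p w) 0 := by
  refine ContinuousAt.comp (g := (chartAt Plane p).symm) ?_ (by fun_prop)
  simpa using (chartAt Plane p).continuousAt_symm (mem_chart_target Plane p)

theorem hasDerivAt_chart_chartRay {ψ : OpenPartialHomeomorph M Plane}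
    (hψ : ψ ∈ IsManifold.maximalAtlas 𝓘(ℝ, Plane) ∞ M) {p : M} (hp : p ∈ ψ.source) (w : Plane) :
    HasDerivAt (fun u => ψ (chartRay p w u)) (chartDeriv ψ p w) 0 := by
  have hφ := IsManifold.chart_mem_maximalAtlas (I := 𝓘(ℝ, Plane)) (n := ∞) p
  set φ := chartAt Plane p with hφdef
  have hpφ : p ∈ φ.source := mem_chart_source Plane p
  have h1 := ((mdifferentiable_of_mem_maximalAtlas hφ).mdifferentiableAt_symm
    (φ.map_source hpφ)).hasMFDerivAt
  have h2 := ((mdifferentiable_of_mem_maximalAtlas hψ).mdifferentiableAt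
    (x := φ.symm (φ p)) (by rwa [φ.left_inv hpφ])).hasMFDerivAt
  have h3 : HasFDerivAt (fun y => ψ (φ.symm y))
    ((chartDeriv ψ (φ.symm (φ p))).comp (chartSymmDeriv φ (φ p))) (φ p) :=
    (h2.comp (φ p) h1).hasFDerivAt
  rw [φ.left_inv hpφ] at h3
  have h4 : HasDerivAt (fun u : ℝ => φ p + u • chartDeriv φ p w) (chartDeriv φ p w) 0 := by
    simpa using ((hasDerivAt_id (0 : ℝ)).smul_const (chartDeriv φ p w)).const_add (φ p)
  have h5 := HasFDerivAt.comp_hasDerivAt (x := (0 : ℝ)) (f := fun u : ℝ => φ p + u • chartDeriv φ p w)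
    (l := fun y => ψ (φ.symm y)) (by simpa using h3) h4
  rwa [ContinuousLinearMap.comp_apply, chartSymmDeriv_chartDeriv hφ hpφ] at h5

theorem eventually_pos_of_hasDerivAt {f : ℝ → ℝ} {m : ℝ} (hf : HasDerivAt f m 0) (h0 : f 0 = 0)
    (hm : 0 < m) : ∀ᶠ u in 𝓝[>] (0 : ℝ), 0 < f u := by
  have h := (hasDerivAt_iff_tendsto_slope.1 hf).mono_left
    (nhdsWithin_mono 0 (fun x (hx : 0 < x) => hx.ne' : Ioi (0 : ℝ) ⊆ {0}ᶜ))
  filter_upwards [h.eventually (lt_mem_nhds hm), self_mem_nhdsWithin] with u hu hu0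
  rw [slope_def_field, h0, sub_zero, sub_zero] at hu
  exact (div_pos_iff_of_pos_right hu0).1 hu

theorem eventually_neg_of_hasDerivAt {f : ℝ → ℝ} {m : ℝ} (hf : HasDerivAt f m 0) (h0 : f 0 = 0)
    (hm : m < 0) : ∀ᶠ u in 𝓝[>] (0 : ℝ), f u < 0 := by
  have := eventually_pos_of_hasDerivAt hf.neg (by simp [h0]) (neg_pos.2 hm)
  exact this.mono fun u hu => by simpa using hu

namespace IsColoredChart

variable {col : M → Bool} {c : ℝ → M} {t : ℝ} {ψ : OpenPartialHomeomorph M Plane} {ε : ℝ}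
  {d : Bool → Bool}

theorem axis_mem_target (h : IsColoredChart col c t ψ ε d) {x : ℝ} (hx : |x| < ε) :
    (!₂[x, 0] : Plane) ∈ ψ.target :=
  h.mem_target _ (by simpa using hx) (by simpa using h.pos)

theorem mem_source (h : IsColoredChart col c t ψ ε d) {x : ℝ} (hx : |x| < ε) :
    c (t + x) ∈ ψ.source := by
  rw [← h.axis x hx]
  exact ψ.map_target (h.axis_mem_target hx)

theorem chart_apply (h : IsColoredChart col c t ψ ε d) {x : ℝ} (hx : |x| < ε) :
    ψ (c (t + x)) = !₂[x, 0] := by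
  rw [← h.axis x hx]
  exact ψ.right_inv (h.axis_mem_target hx)

theorem chartDeriv_planeVelocity (h : IsColoredChart col c t ψ ε d)
    (hc : ∀ s, MDifferentiableAt 𝓘(ℝ, ℝ) 𝓘(ℝ, Plane) c s) {x : ℝ} (hx : |x| < ε) :
    chartDeriv ψ (c (t + x)) (planeVelocity c (t + x)) = EuclideanSpace.single 0 1 := by
  have h1 : HasDerivAt (fun s => ψ (c s)) (chartDeriv ψ (c (t + x)) (planeVelocity c (t + x)))
    (t + x) := hasDerivAt_chart h.mem_maximalAtlas (hc _) (h.mem_source hx)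
  have h2 : HasDerivAt (fun s : ℝ => (s - t) • (EuclideanSpace.single 0 1 : Plane))
      (EuclideanSpace.single 0 1) (t + x) := by
    simpa using ((hasDerivAt_id (t + x)).sub_const t).smul_const (EuclideanSpace.single 0 1 : Plane)
  refine h1.unique (h2.congr_of_eventuallyEq ?_)
  have hev : ∀ᶠ s in 𝓝 (t + x), |s - t| < ε :=
    (by fun_prop : Continuous fun s : ℝ => |s - t|).continuousAt.eventually_lt_const (by simpa)
  filter_upwards [hev] with s hs
  have := h.chart_apply hs
  rw [add_sub_cancel] at this
  rw [this]
  ext i; fin_cases i <;> simp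

/-- The colour next to the curve, on a given side, is that of the adjacent quadrant. -/
theorem eventually_col (h : IsColoredChart col c t ψ ε d)
    (hc : ∀ s, MDifferentiableAt 𝓘(ℝ, ℝ) 𝓘(ℝ, Plane) c s) {x : ℝ} (hx : |x| < ε) {v : Plane}
    (hv : chartDeriv ψ (c (t + x)) v 1 ≠ 0) :
    ∀ᶠ κ in 𝓝[>] (0 : ℝ), ∀ᶠ u in 𝓝[>] (0 : ℝ),
      col (chartRay (c (t + x)) (planeVelocity c (t + x) + κ • v) u) =
        if 0 < chartDeriv ψ (c (t + x)) v 1 then d (decide (0 ≤ x)) else !d (decide (0 ≤ x)) := by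
  set p := c (t + x)
  set α := chartDeriv ψ p v 0
  set β := chartDeriv ψ p v 1
  -- The ray has first coordinate speed 1 + κα. For small `κ` it moves forward along the curve,
  -- whatever the tangential part of `v` is.
  have hev : ∀ᶠ κ in 𝓝[>] (0 : ℝ), 0 < 1 + κ * α := by
    have : Tendsto (fun κ => 1 + κ * α) (𝓝 0) (𝓝 1) := by
      simpa using (by fun_prop : Continuous fun κ => 1 + κ * α).tendsto 0
    exact nhdsWithin_le_nhds (this.eventually_const_lt one_pos)
  filter_upwards [hev, self_mem_nhdsWithin] with κ hκ (hκ0 : 0 < κ)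
  set Z : ℝ → Plane := fun u => ψ (chartRay p (planeVelocity c (t + x) + κ • v) u) with hZ
  have hZd : HasDerivAt Z (EuclideanSpace.single 0 1 + κ • chartDeriv ψ p v) 0 := by
    have := hasDerivAt_chart_chartRay h.mem_maximalAtlas (h.mem_source hx)
      (planeVelocity c (t + x) + κ • v)
    rwa [map_add, map_smul, h.chartDeriv_planeVelocity hc hx] at this
  have hZi : ∀ i, HasDerivAt (fun u => Z u i)
      ((EuclideanSpace.single 0 1 + κ • chartDeriv ψ p v : Plane) i) 0 := fun i =>
    ((EuclideanSpace.proj i : Plane →L[ℝ] ℝ).hasFDerivAt).comp_hasDerivAt 0 hZd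
  have hZ0d : HasDerivAt (fun u => Z u 0) (1 + κ * α) 0 := by simpa using hZi 0
  have hZ1d : HasDerivAt (fun u => Z u 1) (κ * β) 0 := by simpa using hZi 1
  have hZ0 : Z 0 = !₂[x, 0] := by
    rw [hZ]
    simp only [chartRay_zero]
    exact h.chart_apply hx
  have hZ00 : Z 0 0 = x := by simp [hZ0]
  have hZ01 : Z 0 1 = 0 := by simp [hZ0]
  have hc0 : Tendsto (fun u => Z u 0) (𝓝 0) (𝓝 x) := hZ00 ▸ hZ0d.continuousAt.tendsto
  have hc1 : Tendsto (fun u => Z u 1) (𝓝 0) (𝓝 0) := by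
    have := hZ1d.continuousAt.tendsto
    rwa [hZ01] at this
  have e1 : ∀ᶠ u in 𝓝[>] (0 : ℝ), |Z u 0| < ε := nhdsWithin_le_nhds
    (hc0.abs.eventually_lt_const hx)
  have e2 : ∀ᶠ u in 𝓝[>] (0 : ℝ), |Z u 1| < ε := nhdsWithin_le_nhds
    (hc1.abs.eventually_lt_const (by simpa using h.pos))
  have e3 : ∀ᶠ u in 𝓝[>] (0 : ℝ),
      ψ.symm (Z u) = chartRay p (planeVelocity c (t + x) + κ • v) u := by
    have hcr := (continuousAt_chartRay p (planeVelocity c (t + x) + κ • v)).preimage_mem_nhds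
      (t := ψ.source) (ψ.open_source.mem_nhds (by rw [chartRay_zero]; exact h.mem_source hx))
    filter_upwards [nhdsWithin_le_nhds hcr] with u hu using ψ.left_inv hu
  -- At the crossing `x = 0` itself the forward ray enters the right quadrant, whence `0 ≤ x`
  -- instead of a strict inequality.
  have e4 : ∀ᶠ u in 𝓝[>] (0 : ℝ), Z u 0 ≠ 0 ∧ decide (0 < Z u 0) = decide (0 ≤ x) := by
    rcases lt_trichotomy x 0 with hx0 | rfl | hx0
    · filter_upwards [nhdsWithin_le_nhds (hc0.eventually_lt_const hx0)] with u hu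
      exact ⟨hu.ne, by simp [not_lt.2 hu.le, not_le.2 hx0]⟩
    · filter_upwards [eventually_pos_of_hasDerivAt hZ0d hZ00 hκ] with u hu
      exact ⟨hu.ne', by simp [hu]⟩
    · filter_upwards [nhdsWithin_le_nhds (hc0.eventually_const_lt hx0)] with u hu
      exact ⟨hu.ne', by simp [hu, hx0.le]⟩
  split_ifs with hβ
  · filter_upwards [e1, e2, e3, e4, eventually_pos_of_hasDerivAt hZ1d hZ01 (mul_pos hκ0 hβ)]
      with u h1 h2 h3 h4 h5
    rw [← h3, h.upper _ h1 h2 h4.1 h5, h4.2]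
  · filter_upwards [e1, e2, e3, e4, eventually_neg_of_hasDerivAt hZ1d hZ01
      (mul_neg_of_pos_of_neg hκ0 (lt_of_le_of_ne (not_lt.1 hβ) hv))] with u h1 h2 h3 h4 h5
    rw [← h3, h.lower _ h1 h2 h4.1 h5, h4.2]

theorem rightColor_iff (h : IsColoredChart col c t ψ ε d)
    (hc : ∀ s, MDifferentiableAt 𝓘(ℝ, ℝ) 𝓘(ℝ, Plane) c s) {x : ℝ} (hx : |x| < ε) {v : Plane}
    (hv : chartDeriv ψ (c (t + x)) v 1 ≠ 0) :
    RightColor col (c (t + x)) (planeVelocity c (t + x)) v ↔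
      (if 0 < chartDeriv ψ (c (t + x)) v 1 then d (decide (0 ≤ x)) else !d (decide (0 ≤ x)))
        = true := by
  have hev := h.eventually_col hc hx hv
  constructor
  · intro hr
    obtain ⟨κ, h1, h2⟩ := (hev.and hr).exists
    obtain ⟨u, h3, h4⟩ := (h1.and h2).exists
    rw [← h3, h4]
  · intro he
    exact hev.mono fun κ h1 => h1.mono fun u h2 => by rw [h2, he]

end IsColoredChart

/-! ### Unit normal vectors -/

/-- The vector `v` is a unit vector at `p` orthogonal to `e`. -/
def IsUnitNormal (g : SurfaceMetric M) (p : M) (e v : Plane) : Prop :=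
  (g.inner p : Plane →L[ℝ] Plane →L[ℝ] ℝ) v v = 1 ∧ (g.inner p : Plane →L[ℝ] Plane →L[ℝ] ℝ) e v = 0

variable {g : SurfaceMetric M} {p : M}

theorem IsUnitNormal.neg {e v : Plane} (h : IsUnitNormal g p e v) : IsUnitNormal g p e (-v) := by
  have key : ∀ B : Plane →L[ℝ] Plane →L[ℝ] ℝ, B v v = 1 ∧ B e v = 0 →
      B (-v) (-v) = 1 ∧ B e (-v) = 0 := fun B hB => by simpa using hB
  exact key _ h

theorem IsUnitNormal.ne_zero {e v : Plane} (h : IsUnitNormal g p e v) : v ≠ 0 := by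
  rintro rfl
  have key : ∀ B : Plane →L[ℝ] Plane →L[ℝ] ℝ, B 0 0 ≠ 1 := fun B => by simp
  exact key _ h.1

theorem inner_pos (g : SurfaceMetric M) (p : M) {v : Plane} (hv : v ≠ 0) :
    0 < (g.inner p : Plane →L[ℝ] Plane →L[ℝ] ℝ) v v := g.pos p v hv

/-- In the basis `e`, `w`, orthogonality kills the `e`-component of `v`, and unit length makes the
other one 1 or -1. -/
theorem IsUnitNormal.eq_or_eq_neg {e v w : Plane} (he : e ≠ 0) (hv : IsUnitNormal g p e v)
    (hw : IsUnitNormal g p e w) : v = w ∨ v = -w := by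
  set B : Plane →L[ℝ] Plane →L[ℝ] ℝ := g.inner p with hB
  have hee : B e e ≠ 0 := (inner_pos g p he).ne'
  have hv1 : B v v = 1 := hv.1
  have hw1 : B w w = 1 := hw.1
  have hv2 : B e v = 0 := hv.2
  have hw2 : B e w = 0 := hw.2
  have hlin : LinearIndependent ℝ ![e, w] := by
    rw [LinearIndependent.pair_iff' he]
    rintro a rfl
    rw [map_smul, smul_eq_mul] at hw2
    obtain rfl : a = 0 := (mul_eq_zero.1 hw2).resolve_right hee
    simp at hw1
  obtain ⟨L, hL⟩ := exists_continuousLinearEquiv hlin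
  obtain ⟨z, hz⟩ := L.surjective v
  rw [hL] at hz
  rw [← hz, map_add, map_smul, map_smul, hw2, smul_zero, add_zero, smul_eq_mul] at hv2
  have h0 : z 0 = 0 := (mul_eq_zero.1 hv2).resolve_right hee
  rw [h0, zero_smul, zero_add] at hz
  rw [← hz] at hv1
  simp only [map_smul, smul_apply, smul_eq_mul, hw1, mul_one] at hv1
  rcases mul_self_eq_one_iff.1 hv1 with h | h
  · left; rw [← hz, h, one_smul]
  · right; rw [← hz, h, neg_one_smul]

/-- A vector orthogonal to the first coordinate direction of a chart, in coordinates. -/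
noncomputable def chartOrthogonal (g : SurfaceMetric M) (ψ : OpenPartialHomeomorph M Plane)
    (y : Plane) : Plane := !₂[-coeff g ψ y 0 1, coeff g ψ y 0 0]

/-- The square of the length of `chartOrthogonal`. -/
noncomputable def chartOrthogonalSq (g : SurfaceMetric M) (ψ : OpenPartialHomeomorph M Plane)
    (y : Plane) : ℝ :=
  (g.inner (ψ.symm y) : Plane →L[ℝ] Plane →L[ℝ] ℝ) (chartSymmDeriv ψ y (chartOrthogonal g ψ y))
    (chartSymmDeriv ψ y (chartOrthogonal g ψ y))

/-- The unit normal vector to the first coordinate direction of a chart, in coordinates. -/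
noncomputable def chartNormal (g : SurfaceMetric M) (ψ : OpenPartialHomeomorph M Plane)
    (y : Plane) : Plane := (√(chartOrthogonalSq g ψ y))⁻¹ • chartOrthogonal g ψ y

variable {ψ : OpenPartialHomeomorph M Plane}

theorem coeff_zero_zero_pos
    (hψ : ψ ∈ IsManifold.maximalAtlas 𝓘(ℝ, Plane) ∞ M) {y : Plane} (hy : y ∈ ψ.target) : 0 < coeff g ψ y 0 0 := by
  refine inner_mfderiv_symm_pos g hψ hy (v := EuclideanSpace.single 0 (1 : ℝ)) fun h => ?_
  simpa using congrArg (fun v : Plane => v 0) h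

theorem chartOrthogonalSq_pos
    (hψ : ψ ∈ IsManifold.maximalAtlas 𝓘(ℝ, Plane) ∞ M) {y : Plane} (hy : y ∈ ψ.target) : 0 < chartOrthogonalSq g ψ y := by
  refine inner_mfderiv_symm_pos g hψ hy fun h => (coeff_zero_zero_pos (g := g) hψ hy).ne' ?_
  simpa [chartOrthogonal] using congrArg (fun v : Plane => v 1) h

theorem contDiffOn_chartNormal
    (hψ : ψ ∈ IsManifold.maximalAtlas 𝓘(ℝ, Plane) ∞ M) : ContDiffOn ℝ ∞ (chartNormal g ψ) ψ.target := by
  have hV : ContDiffOn ℝ ∞ (chartOrthogonal g ψ) ψ.target := by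
    rw [contDiffOn_euclidean]
    intro i
    fin_cases i
    exacts [(contDiffOn_coeff g hψ 0 1).neg, contDiffOn_coeff g hψ 0 0]
  have hQ : ContDiffOn ℝ ∞ (chartOrthogonalSq g ψ) ψ.target :=
    contDiffOn_inner_mfderiv_symm g hψ hV hV
  have hpos : ∀ y ∈ ψ.target, chartOrthogonalSq g ψ y ≠ 0 := fun y hy =>
    (chartOrthogonalSq_pos hψ hy).ne'
  exact ((hQ.sqrt hpos).inv fun y hy => (Real.sqrt_pos.2 (chartOrthogonalSq_pos hψ hy)).ne').smul hV

theorem isUnitNormal_chartNormal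
    (hψ : ψ ∈ IsManifold.maximalAtlas 𝓘(ℝ, Plane) ∞ M) {y : Plane} (hy : y ∈ ψ.target) :
    IsUnitNormal g (ψ.symm y) (chartSymmDeriv ψ y (EuclideanSpace.single 0 1))
      (chartSymmDeriv ψ y (chartNormal g ψ y)) := by
  have hQ := chartOrthogonalSq_pos (g := g) hψ hy
  have hs := Real.sqrt_pos.2 hQ
  set B : Plane →L[ℝ] Plane →L[ℝ] ℝ := g.inner (ψ.symm y) with hB
  constructor
  · change B _ _ = 1
    have hQ' : B (chartSymmDeriv ψ y (chartOrthogonal g ψ y))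
      (chartSymmDeriv ψ y (chartOrthogonal g ψ y)) = chartOrthogonalSq g ψ y := rfl
    simp only [chartNormal, map_smul, smul_apply, smul_eq_mul, hQ']
    nth_rewrite 3 [← Real.mul_self_sqrt hQ.le]
    field_simp
  · change B _ _ = 0
    have h00 : coeff g ψ y 0 0 = B (chartSymmDeriv ψ y (EuclideanSpace.single 0 1))
      (chartSymmDeriv ψ y (EuclideanSpace.single 0 1)) := rfl
    have h01 : coeff g ψ y 0 1 = B (chartSymmDeriv ψ y (EuclideanSpace.single 0 1))
      (chartSymmDeriv ψ y (EuclideanSpace.single 1 1)) := rfl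
    have hV : chartOrthogonal g ψ y = -coeff g ψ y 0 1 • EuclideanSpace.single 0 1 +
        coeff g ψ y 0 0 • EuclideanSpace.single 1 1 := by
      ext i; fin_cases i <;> simp [chartOrthogonal]
    rw [chartNormal, hV]
    simp only [map_smul, map_add, smul_eq_mul, ← h00, ← h01]
    ring

/-- This says that the normal points to the upper side of the chart. -/
theorem chartNormal_one_pos
    (hψ : ψ ∈ IsManifold.maximalAtlas 𝓘(ℝ, Plane) ∞ M) {y : Plane} (hy : y ∈ ψ.target) : 0 < chartNormal g ψ y 1 := by
  have h1 := Real.sqrt_pos.2 (chartOrthogonalSq_pos (g := g) hψ hy)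
  have h2 := coeff_zero_zero_pos (g := g) hψ hy
  simpa [chartNormal, chartOrthogonal] using mul_pos (inv_pos.2 h1) h2

end Sides

/-! ### The parity of the number of crossings -/

/-- The sign which changes at each point of `V`. -/
noncomputable def crossingSign (V : Set ℝ) (t : ℝ) : ℝ := (-1) ^ (V ∩ uIoc 0 t).ncard

/-- Counts over adjacent half-open intervals add up; for negative times the relation persists
because signs are their own inverses. -/
theorem crossingSign_mul {V : Set ℝ} (hV : ∀ a b, (V ∩ Icc a b).Finite) {a b : ℝ} (hab : a ≤ b) :
    crossingSign V b = crossingSign V a * (-1) ^ (V ∩ Ioc a b).ncard := by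
  have hfin : ∀ a b, (V ∩ Ioc a b).Finite := fun a b =>
    (hV a b).subset (inter_subset_inter_right V Ioc_subset_Icc_self)
  have hadd : ∀ {a b c : ℝ}, a ≤ b → b ≤ c →
      (V ∩ Ioc a c).ncard = (V ∩ Ioc a b).ncard + (V ∩ Ioc b c).ncard := by
    intro a b c h1 h2
    rw [← Ioc_union_Ioc_eq_Ioc h1 h2, inter_union_distrib_left,
      ncard_union_eq (disjoint_left.2 fun x hx hx' => absurd hx.2.2 (not_le.2 hx'.2.1))
        (hfin _ _) (hfin _ _)]
  have hsq : ∀ k : ℕ, (-1 : ℝ) ^ k * (-1) ^ k = 1 := fun k => by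
    rw [← mul_pow]; simp
  unfold crossingSign
  rcases le_total 0 a with ha | ha
  · rw [uIoc_of_le ha, uIoc_of_le (ha.trans hab), hadd ha hab, pow_add]
  · rcases le_total 0 b with hb | hb
    · rw [uIoc_of_ge ha, uIoc_of_le hb, hadd ha hb, pow_add, ← mul_assoc, hsq, one_mul]
    · rw [uIoc_of_ge ha, uIoc_of_ge hb, hadd hab hb, pow_add, mul_right_comm, hsq, one_mul]

theorem crossingSign_zero (V : Set ℝ) : crossingSign V 0 = 1 := by simp [crossingSign]

theorem crossingSign_mul_self (V : Set ℝ) (t : ℝ) : crossingSign V t * crossingSign V t = 1 := by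
  rw [crossingSign, ← mul_pow]; simp

-- The sign is right-continuous, since `uIoc` includes its larger endpoint. This matches the
-- forward-looking convention of `RightColor`, so both change at the same moment.
open Classical in
theorem eventually_crossingSign {V : Set ℝ} (hV : ∀ a b, (V ∩ Icc a b).Finite) (t : ℝ) :
    ∀ᶠ s in 𝓝 t, crossingSign V s =
      if t ≤ s ∨ t ∉ V then crossingSign V t else -crossingSign V t := by
  have hF : ((V ∩ Icc (t - 1) (t + 1)) \ {t}).Finite := (hV _ _).subset sdiff_subset
  obtain ⟨r, hr, hsub⟩ := Metric.isOpen_iff.1 hF.isClosed.isOpen_compl t (by simp)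
  filter_upwards [Ioo_mem_nhds (by linarith : t - 1 < t) (by linarith : t < t + 1),
    Metric.ball_mem_nhds t hr] with s hs1 hs
  rw [Metric.mem_ball, Real.dist_eq, abs_lt] at hs
  have hno : ∀ x, |x - t| ≤ |s - t| → x ∈ V → x = t := by
    intro x hx hxV
    have h1 : |s - t| < r := abs_lt.2 hs
    have h2 : |s - t| < 1 := abs_lt.2 ⟨by linarith [hs1.1], by linarith [hs1.2]⟩
    by_contra hne
    have h3 := abs_lt.1 (hx.trans_lt h2)
    exact hsub (show x ∈ Metric.ball t r by
      rw [Metric.mem_ball, Real.dist_eq]; exact hx.trans_lt h1)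
      ⟨⟨hxV, by linarith, by linarith⟩, hne⟩
  rcases le_or_gt t s with hts | hts
  · rw [if_pos (Or.inl hts), crossingSign_mul hV hts]
    have : V ∩ Ioc t s = ∅ := by
      refine eq_empty_iff_forall_notMem.2 fun x hx => hx.2.1.ne' (hno x ?_ hx.1)
      rw [abs_of_pos (sub_pos.2 hx.2.1), abs_of_nonneg (sub_nonneg.2 hts)]
      linarith [hx.2.2]
    simp [this]
  · have hle : ∀ x ∈ Ioc s t, |x - t| ≤ |s - t| := fun x hx => by
      rw [abs_of_nonpos (by linarith [hx.2]), abs_of_neg (by linarith)]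
      linarith [hx.1]
    have hm := crossingSign_mul hV hts.le
    by_cases htV : t ∈ V
    · rw [if_neg (by simp [not_le.2 hts, htV])]
      have : V ∩ Ioc s t = {t} := by
        refine Subset.antisymm (fun x hx => hno x (hle x hx.2) hx.1) ?_
        rintro x rfl
        exact ⟨htV, hts, le_rfl⟩
      rw [this] at hm
      simp only [ncard_singleton, pow_one] at hm
      linarith
    · rw [if_pos (Or.inr htV)]
      have : V ∩ Ioc s t = ∅ := by
        refine eq_empty_iff_forall_notMem.2 fun x hx => htV ?_
        rw [← hno x (hle x hx.2) hx.1]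
        exact hx.1
      rw [this] at hm
      simpa using hm.symm

/-! ### Normal fields along a curve -/

section NormalFields

variable {M : Type*} [TopologicalSpace M] [ChartedSpace Plane M] [IsManifold 𝓘(ℝ, Plane) ∞ M]
  {g : SurfaceMetric M}

/-- A tangent vector with given coordinates, as a point of the tangent bundle. -/
def tangentPoint (p : M) (v : Plane) : TangentBundle 𝓘(ℝ, Plane) M := ⟨p, v⟩

/-- Translates continuity in the tangent bundle into continuity of coordinates in an arbitrary
smooth chart. -/
theorem continuousAt_chartDeriv {ψ : OpenPartialHomeomorph M Plane}
    (hψ : ψ ∈ IsManifold.maximalAtlas 𝓘(ℝ, Plane) ∞ M) {c : ℝ → M} {ν : ℝ → Plane} {t : ℝ}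
    (hν : ContinuousAt (fun s => tangentPoint (c s) (ν s)) t) (ht : c t ∈ ψ.source) :
    ContinuousAt (fun s => chartDeriv ψ (c s) (ν s)) t := by
  have h1 := (contMDiffOn_of_mem_maximalAtlas hψ).continuousOn_tangentMapWithin (by simp)
    ψ.open_source.uniqueMDiffOn
  have hc : ContinuousAt c t :=
    (FiberBundle.continuous_proj Plane (TangentSpace 𝓘(ℝ, Plane))).continuousAt.comp hν
  have hopen : IsOpen (Bundle.TotalSpace.proj ⁻¹' ψ.source :
      Set (TangentBundle 𝓘(ℝ, Plane) M)) :=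
    ψ.open_source.preimage (FiberBundle.continuous_proj Plane (TangentSpace 𝓘(ℝ, Plane)))
  have h2 : ContinuousAt (fun s => tangentMapWithin 𝓘(ℝ, Plane) 𝓘(ℝ, Plane) ψ ψ.source
      (tangentPoint (c s) (ν s))) t :=
    ContinuousAt.comp (g := tangentMapWithin 𝓘(ℝ, Plane) 𝓘(ℝ, Plane) ψ ψ.source)
      (h1.continuousAt (hopen.mem_nhds ht)) hν
  have h3 := (contMDiff_snd_tangentBundle_modelSpace (n := 0) Plane
    𝓘(ℝ, Plane)).continuous.continuousAt.comp h2
  refine h3.congr ?_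
  filter_upwards [hc.preimage_mem_nhds (ψ.open_source.mem_nhds ht)] with s hs
  exact congrArg (fun L : Plane →L[ℝ] Plane => L (ν s))
    (mfderivWithin_of_isOpen (f := ψ) ψ.open_source hs)

theorem continuousAt_chartSymmDeriv {ψ : OpenPartialHomeomorph M Plane}
    (hψ : ψ ∈ IsManifold.maximalAtlas 𝓘(ℝ, Plane) ∞ M) {v : Plane → Plane}
    (hv : ContDiffOn ℝ ∞ v ψ.target) {y : Plane} (hy : y ∈ ψ.target) :
    ContinuousAt (fun y => tangentPoint (ψ.symm y) (chartSymmDeriv ψ y (v y))) y :=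
  (contMDiffOn_mfderiv_symm hψ hv).continuousOn.continuousAt (ψ.open_target.mem_nhds hy)

variable {col : M → Bool} {c : ℝ → M} {t : ℝ} {ψ : OpenPartialHomeomorph M Plane} {ε : ℝ}
  {d : Bool → Bool}

namespace IsColoredChart

/-- The unit normal vector on the upper side of the curve. -/
noncomputable def normal (g : SurfaceMetric M) (ψ : OpenPartialHomeomorph M Plane) (x : ℝ) : Plane :=
  chartSymmDeriv ψ !₂[x, 0] (chartNormal g ψ !₂[x, 0])

theorem isUnitNormal_normal (h : IsColoredChart col c t ψ ε d)
    (hc : ∀ s, MDifferentiableAt 𝓘(ℝ, ℝ) 𝓘(ℝ, Plane) c s) {x : ℝ} (hx : |x| < ε) :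
    IsUnitNormal g (c (t + x)) (planeVelocity c (t + x)) (normal g ψ x) := by
  have h1 := isUnitNormal_chartNormal (g := g) h.mem_maximalAtlas (h.axis_mem_target hx)
  have h2 := chartSymmDeriv_chartDeriv h.mem_maximalAtlas (h.mem_source hx)
    (planeVelocity c (t + x))
  rw [h.chartDeriv_planeVelocity hc hx, h.chart_apply hx] at h2
  rwa [h2, h.axis x hx] at h1

theorem chartDeriv_normal_pos (h : IsColoredChart col c t ψ ε d) {x : ℝ} (hx : |x| < ε) :
    0 < chartDeriv ψ (c (t + x)) (normal g ψ x) 1 := by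
  have := chartDeriv_chartSymmDeriv h.mem_maximalAtlas (h.axis_mem_target hx)
    (chartNormal g ψ !₂[x, 0])
  rw [h.axis x hx] at this
  rw [normal, this]
  exact chartNormal_one_pos h.mem_maximalAtlas (h.axis_mem_target hx)

theorem chartDeriv_ne_zero (h : IsColoredChart col c t ψ ε d)
    (hc : ∀ s, MDifferentiableAt 𝓘(ℝ, ℝ) 𝓘(ℝ, Plane) c s) (hv : ∀ s, planeVelocity c s ≠ 0)
    {x : ℝ} (hx : |x| < ε) {v : Plane}
    (hn : IsUnitNormal g (c (t + x)) (planeVelocity c (t + x)) v) :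
    chartDeriv ψ (c (t + x)) v 1 ≠ 0 := by
  have hpos := h.chartDeriv_normal_pos (g := g) hx
  rcases hn.eq_or_eq_neg (hv _) (h.isUnitNormal_normal hc hx) with rfl | rfl
  · exact hpos.ne'
  · rw [map_neg]
    simpa using hpos.ne'

/-- The sign attached to a colour. -/
def colorSign (b : Bool) : ℝ := bif b then 1 else -1

/-- The unit normal on the side of colour `true`. -/
theorem isUnitNormal_and_rightColor_iff (h : IsColoredChart col c t ψ ε d)
    (hc : ∀ s, MDifferentiableAt 𝓘(ℝ, ℝ) 𝓘(ℝ, Plane) c s) (hv : ∀ s, planeVelocity c s ≠ 0)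
    {x : ℝ} (hx : |x| < ε) {v : Plane} :
    IsUnitNormal g (c (t + x)) (planeVelocity c (t + x)) v ∧
      RightColor col (c (t + x)) (planeVelocity c (t + x)) v ↔
    v = colorSign (d (decide (0 ≤ x))) • normal g ψ x := by
  have hn := h.isUnitNormal_normal (g := g) hc hx
  have hpos := h.chartDeriv_normal_pos (g := g) hx
  have hneg : ¬0 < chartDeriv ψ (c (t + x)) (-normal g ψ x) 1 := by
    rw [map_neg]; simpa using hpos.le
  have h1 := h.rightColor_iff hc hx hpos.ne'
  have h2 := h.rightColor_iff hc hx (h.chartDeriv_ne_zero hc hv hx hn.neg)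
  rw [if_pos hpos] at h1
  rw [if_neg hneg] at h2
  have hne : normal g ψ x ≠ -normal g ψ x := by
    intro he
    rw [← he] at hneg
    exact hneg hpos
  constructor
  · rintro ⟨hv1, hv2⟩
    rcases hv1.eq_or_eq_neg (hv _) hn with rfl | rfl
    · rw [h1.1 hv2]; simp [colorSign]
    · have := h2.1 hv2
      rw [Bool.not_eq_true'] at this
      rw [this]; simp [colorSign]
  · rintro rfl
    cases hd : d (decide (0 ≤ x))
    · rw [hd] at h2
      simpa [colorSign] using ⟨hn.neg, h2.2 rfl⟩
    · rw [hd] at h1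
      simpa [colorSign] using ⟨hn, h1.2 rfl⟩

end IsColoredChart

/-- Two continuous fields of unit normals which agree at one point agree everywhere. -/
theorem eq_of_continuous_isUnitNormal
    (hc : ∀ s, MDifferentiableAt 𝓘(ℝ, ℝ) 𝓘(ℝ, Plane) c s) (hv : ∀ s, planeVelocity c s ≠ 0)
    (hchart : ∀ t, ∃ ψ ε d, IsColoredChart col c t ψ ε d) {μ ν : ℝ → Plane}
    (hμ : Continuous fun s => tangentPoint (c s) (μ s))
    (hν : Continuous fun s => tangentPoint (c s) (ν s))
    (hμn : ∀ s, IsUnitNormal g (c s) (planeVelocity c s) (μ s))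
    (hνn : ∀ s, IsUnitNormal g (c s) (planeVelocity c s) (ν s)) (s t : ℝ) (hs : μ s = ν s) :
    μ t = ν t := by
  have hloc : IsLocallyConstant fun s => μ s = ν s := by
    rw [IsLocallyConstant.iff_eventually_eq]
    intro t
    obtain ⟨ψ, ε, d, h⟩ := hchart t
    have ht : c t ∈ ψ.source := by simpa using h.mem_source (x := 0) (by simpa using h.pos)
    -- Two unit normals are equal or opposite, and this continuous function is positive in the first
    -- case and negative in the second. Agreement is therefore locally constant.
    set f : ℝ → ℝ := fun s => chartDeriv ψ (c s) (μ s) 1 * chartDeriv ψ (c s) (ν s) 1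
    have hpr : Continuous fun z : Plane => z 1 := by fun_prop
    have hf : ContinuousAt f t :=
      (hpr.continuousAt.comp (continuousAt_chartDeriv h.mem_maximalAtlas hμ.continuousAt ht)).mul
        (hpr.continuousAt.comp (continuousAt_chartDeriv h.mem_maximalAtlas hν.continuousAt ht))
    have key : ∀ s, |s - t| < ε → (μ s = ν s ∧ 0 < f s) ∨ (μ s ≠ ν s ∧ f s < 0) := by
      intro s hs
      have hne := h.chartDeriv_ne_zero hc hv hs (v := ν s) (g := g) (by
        rw [add_sub_cancel]; exact hνn s)
      rw [add_sub_cancel] at hne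
      rcases (hμn s).eq_or_eq_neg (hv s) (hνn s) with he | he
      · left
        refine ⟨he, ?_⟩
        simp only [f, he]
        exact mul_self_pos.2 hne
      · right
        constructor
        · intro he'
          rw [he'] at he
          have := congrArg (fun v => chartDeriv ψ (c s) v 1) he
          simp only [map_neg, PiLp.neg_apply] at this
          exact hne (by linarith)
        · simp only [f, he, map_neg, PiLp.neg_apply, neg_mul, neg_neg_iff_pos]
          exact mul_self_pos.2 hne
    have hev : ∀ᶠ s in 𝓝 t, |s - t| < ε :=
      (by fun_prop : Continuous fun s : ℝ => |s - t|).continuousAt.eventually_lt_const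
        (by simpa using h.pos)
    have ht0 := key t (by simpa using h.pos)
    rcases ht0 with ⟨h1, h2⟩ | ⟨h1, h2⟩
    · filter_upwards [hev, hf.tendsto.eventually_const_lt h2] with s hs hs'
      rcases key s hs with ⟨h3, h4⟩ | ⟨h3, h4⟩
      · simp [h1, h3]
      · linarith
    · filter_upwards [hev, hf.tendsto.eventually_lt_const h2] with s hs hs'
      rcases key s hs with ⟨h3, h4⟩ | ⟨h3, h4⟩
      · linarith
      · simp [h1, h3]
  have := hloc.apply_eq_of_preconnectedSpace s t
  exact this ▸ hs

/-- Along a curve in a coloured complement there is a continuous field of unit normals which, up to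
the sign counting the crossings, points to the domains of colour `true`. -/
theorem exists_continuous_isUnitNormal
    (hc : ∀ s, MDifferentiableAt 𝓘(ℝ, ℝ) 𝓘(ℝ, Plane) c s) (hv : ∀ s, planeVelocity c s ≠ 0)
    {V : Set ℝ} (hV : ∀ a b, (V ∩ Icc a b).Finite)
    (hchart : ∀ t, ∃ ψ ε d, IsColoredChart col c t ψ ε d ∧ (d true ≠ d false ↔ t ∈ V)) :
    ∃ w : ℝ → Plane, (∀ s, IsUnitNormal g (c s) (planeVelocity c s) (w s)) ∧
      (∀ s t, c s = c t → planeVelocity c s = planeVelocity c t → w s = w t) ∧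
      Continuous fun s => tangentPoint (c s) (crossingSign V s • w s) := by
  have hex : ∀ t, ∃! v, IsUnitNormal g (c t) (planeVelocity c t) v ∧
      RightColor col (c t) (planeVelocity c t) v := by
    intro t
    obtain ⟨ψ, ε, d, h, -⟩ := hchart t
    have := fun v => h.isUnitNormal_and_rightColor_iff (g := g) (v := v) hc hv (x := 0)
      (by simpa using h.pos)
    simp only [add_zero] at this
    exact ⟨_, (this _).2 rfl, fun v hv => (this v).1 hv⟩
  -- The defining property of `w` involves only position and velocity, so uniqueness makes `w` a
  -- function of these; periodicity will follow.
  choose w hw hwu using hex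
  refine ⟨w, fun s => (hw s).1, fun s t h1 h2 => ?_, ?_⟩
  · refine hwu t (w s) ?_
    have := hw s
    simp only [h1, h2] at this
    exact this
  · rw [continuous_iff_continuousAt]
    intro t
    obtain ⟨ψ, ε, d, h, hd⟩ := hchart t
    -- In the chart, `w` is the upper normal times the colour sign. At a crossing both this sign and
    -- `crossingSign` flip, so their product is the constant `σ`.
    set σ : ℝ := crossingSign V t * IsColoredChart.colorSign (d true)
    have hv : ContDiffOn ℝ ∞ (fun y => σ • chartNormal g ψ y) ψ.target :=
      (contDiffOn_chartNormal h.mem_maximalAtlas).const_smul σ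
    have hev : ∀ᶠ s in 𝓝 t, |s - t| < ε :=
      (by fun_prop : Continuous fun s : ℝ => |s - t|).continuousAt.eventually_lt_const
        (by simpa using h.pos)
    have hcont : ContinuousAt (fun s : ℝ => tangentPoint (ψ.symm !₂[s - t, 0])
        (chartSymmDeriv ψ !₂[s - t, 0] (σ • chartNormal g ψ !₂[s - t, 0]))) t := by
      have h1 : ContinuousAt (fun s : ℝ => (!₂[s - t, 0] : Plane)) t := by fun_prop
      exact ContinuousAt.comp (f := fun s : ℝ => (!₂[s - t, 0] : Plane))
        (continuousAt_chartSymmDeriv h.mem_maximalAtlas hv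
          (h.axis_mem_target (by simpa using h.pos))) h1
    refine hcont.congr ?_
    filter_upwards [hev, eventually_crossingSign hV t] with s hs hsign
    have hws := (h.isUnitNormal_and_rightColor_iff (g := g) (v := w s) hc ‹_› hs).1
      (by rw [add_sub_cancel]; exact hw s)
    have hax := h.axis _ hs
    rw [add_sub_cancel] at hax
    rw [hax, hws, hsign, map_smul, smul_smul]
    change tangentPoint (c s) (σ • IsColoredChart.normal g ψ (s - t)) = _
    congr 2
    by_cases hst : t ≤ s
    · simp [hst, σ]
    · by_cases htV : t ∈ V
      · have hne := hd.2 htV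
        simp only [hst, htV, not_true, or_self, if_false, sub_nonneg, decide_false, σ]
        cases h1 : d true <;> cases h2 : d false <;> simp_all [IsColoredChart.colorSign]
      · have heq : d true = d false := not_not.1 fun h' => htV (hd.1 h')
        simp [hst, htV, σ, heq]

variable [T2Space M]

/-- The field `crossingSign V s • w s` is a continuous unit normal, and after one period it returns
multiplied by the parity sign, as `w` is periodic. Any other continuous unit normal field coincides
with it everywhere as soon as it does so once. -/
theorem reversesOrientation_iff (γ : ClosedGeodesic g) {V : Set ℝ}
    (hV : ∀ a b, (V ∩ Icc a b).Finite)
    (hchart : ∀ t, ∃ ψ ε d, IsColoredChart col γ.curve t ψ ε d ∧ (d true ≠ d false ↔ t ∈ V)) :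
    ReversesOrientation γ ↔ Odd (V ∩ Ioc 0 γ.period).ncard := by
  have hc := γ.isGeodesic.mdifferentiableAt
  have hv := γ.planeVelocity_ne_zero
  obtain ⟨w, hw, hwper, hcont⟩ := exists_continuous_isUnitNormal (g := g) hc hv hV hchart
  have hT : γ.curve γ.period = γ.curve 0 := by simpa using γ.periodic 0
  have hwT : w γ.period = w 0 := hwper _ _ hT (by simpa using γ.planeVelocity_periodic 0)
  have hnormal : ∀ s, IsUnitNormal g (γ.curve s) (planeVelocity γ.curve s)
      (crossingSign V s • w s) := by
    intro s
    rcases mul_self_eq_one_iff.1 (crossingSign_mul_self V s) with h | h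
    · rw [h, one_smul]; exact hw s
    · rw [h, neg_one_smul]; exact (hw s).neg
  have hsignT : crossingSign V γ.period = (-1) ^ (V ∩ Ioc 0 γ.period).ncard := by
    rw [crossingSign, uIoc_of_le γ.period_pos.le]
  have heqT : ∀ v : Plane, tangentPoint (γ.curve γ.period) v = tangentPoint (γ.curve 0) v :=
    fun v => by rw [hT]
  constructor
  · rintro ⟨ν, hνc, hν1, hν2, hνT⟩
    set μ : ℝ → Plane := ν with hμ
    have hμn : ∀ s, IsUnitNormal g (γ.curve s) (planeVelocity γ.curve s) (μ s) :=
      fun s => ⟨hν1 s, hν2 s⟩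
    have hμT : μ γ.period = -μ 0 :=
      congrArg (fun z : TangentBundle 𝓘(ℝ, Plane) M => (z.2 : Plane)) hνT
    by_contra hodd
    have hsT : crossingSign V γ.period = 1 := by
      rw [hsignT, (Nat.not_odd_iff_even.1 hodd).neg_one_pow]
    have heq := eq_of_continuous_isUnitNormal hc hv
      (fun t => (hchart t).imp fun ψ h => h.imp fun ε h => h.imp fun d h => h.1) hνc hcont hμn
      hnormal
    have hw0 := (hw 0).ne_zero
    have hne : w 0 ≠ -w 0 := fun h => by
      rw [eq_neg_iff_add_eq_zero, ← two_smul ℝ, smul_eq_zero] at h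
      exact hw0 (h.resolve_left two_ne_zero)
    -- If the reversing field starts at `-w 0`, then it ends at `w 0`, so the comparison begins at
    -- the end of the period instead of at 0.
    rcases (hμn 0).eq_or_eq_neg (hv 0) (hw 0) with h0 | h0
    · have := heq 0 γ.period (by rw [crossingSign_zero, one_smul]; exact h0)
      rw [hsT, one_smul, hwT] at this
      exact hne (this.symm.trans (hμT.trans (by rw [h0])))
    · have := heq γ.period 0 (by
        rw [hsT, one_smul, hwT]
        exact hμT.trans (by rw [h0, neg_neg]))
      rw [crossingSign_zero, one_smul] at this
      exact hne (this.symm.trans h0)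
  · intro hodd
    refine ⟨fun s => (crossingSign V s • w s : Plane), hcont, fun s => (hnormal s).1,
      fun s => (hnormal s).2, ?_⟩
    change tangentPoint (γ.curve γ.period) (crossingSign V γ.period • w γ.period) =
      tangentPoint (γ.curve 0) (-(crossingSign V 0 • w 0))
    rw [heqT, hwT, hsignT, hodd.neg_one_pow, crossingSign_zero, neg_one_smul, one_smul]

end NormalFields

/-! ### Parity of the number of passages through intersection points. -/

section Counting

variable {M : Type*} [TopologicalSpace M] [ChartedSpace Plane M] [IsManifold 𝓘(ℝ, Plane) ∞ M]
  {g : SurfaceMetric M} [T2Space M]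

/-- Infinitely many visits to one point in a bounded time would accumulate, contradicting local
injectivity. -/
theorem ClosedGeodesic.finite_preimage_inter_Icc (γ : ClosedGeodesic g) {S : Set M}
    (hS : S.Finite) (a b : ℝ) : (γ.curve ⁻¹' S ∩ Icc a b).Finite := by
  have key : ∀ v, (γ.curve ⁻¹' {v} ∩ Icc a b).Finite := by
    intro v
    by_contra hinf
    obtain ⟨x, -, hx⟩ := Infinite.exists_accPt_of_subset_isCompact hinf isCompact_Icc
      inter_subset_right
    rw [accPt_iff_frequently] at hx
    have hxv : γ.curve x = v := by
      have hcl : IsClosed (γ.curve ⁻¹' {v}) := isClosed_singleton.preimage γ.continuous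
      exact hcl.closure_subset (mem_closure_iff_frequently.2 (hx.mono fun y hy => hy.2.1))
    obtain ⟨ε, hε, hε0⟩ := ((γ.isGeodesic.injOn_near (γ.planeVelocity_ne_zero x)).and
      self_mem_nhdsWithin).exists
    obtain ⟨y, ⟨hyx, hy⟩, hyε⟩ := (hx.and_eventually (Metric.ball_mem_nhds x hε0)).exists
    rw [Real.dist_eq] at hyε
    have := hε (y - x) 0 hyε (by simpa using hε0) (by
      rw [add_sub_cancel, add_zero, hxv]; exact hy.1)
    exact hyx (sub_eq_zero.1 this)
  refine (hS.biUnion fun v _ => key v).subset fun t ht => ?_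
  exact mem_biUnion ht.1 ⟨rfl, ht.2⟩

variable {n : ℕ} {γ : Fin n → ClosedGeodesic g}

theorem isIntersectionPoint_of_mem_intersectionsWithOthers {i : Fin n} {p : M}
    (hp : p ∈ intersectionsWithOthers γ i) : IsIntersectionPoint γ p := by
  obtain ⟨⟨t, rfl⟩, j, hji, u, hu⟩ := hp
  obtain ⟨t₀, ht₀, -⟩ := exists_passage γ i t
  obtain ⟨u₀, hu₀, -⟩ := exists_passage γ j u
  rw [hu] at hu₀
  exact ⟨_, ht₀, _, hu₀, fun h => hji (congrArg Prod.fst h).symm⟩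

/-- Reconciles `crossingSign`, which counts over (0, T], with `passages`, which uses [0, T). -/
theorem ncard_inter_Ioc_eq_ncard_inter_Ico {V : Set ℝ} (hV : ∀ a b, (V ∩ Icc a b).Finite) {T : ℝ}
    (hT : 0 < T) (h0 : 0 ∈ V ↔ T ∈ V) : (V ∩ Ioc 0 T).ncard = (V ∩ Ico 0 T).ncard := by
  by_cases h : 0 ∈ V
  · have e1 : V ∩ Icc 0 T = insert 0 (V ∩ Ioc 0 T) := by
      rw [← Ioc_insert_left hT.le, inter_insert_of_mem h]
    have e2 : V ∩ Icc 0 T = insert T (V ∩ Ico 0 T) := by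
      rw [← Ico_insert_right hT.le, inter_insert_of_mem (h0.1 h)]
    have f1 := ncard_insert_of_notMem (a := 0) (s := V ∩ Ioc 0 T) (by simp)
      ((hV 0 T).subset (inter_subset_inter_right V Ioc_subset_Icc_self))
    have f2 := ncard_insert_of_notMem (a := T) (s := V ∩ Ico 0 T) (by simp)
      ((hV 0 T).subset (inter_subset_inter_right V Ico_subset_Icc_self))
    rw [← e1] at f1
    rw [← e2] at f2
    omega
  · congr 1
    ext x
    refine and_congr_right fun hx => ⟨fun hx' => ⟨hx'.1.le, lt_of_le_of_ne hx'.2 ?_⟩,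
      fun hx' => ⟨lt_of_le_of_ne hx'.1 ?_, hx'.2.le⟩⟩
    · rintro rfl; exact h (h0.2 hx)
    · rintro rfl; exact h hx

open Classical in
/-- If all intersection points are double points, the number of passages of the `i`-th geodesic
through intersection points has the parity of the number of its intersections with the others. -/
theorem odd_ncard_passages_iff (hdouble : ∀ p, IsIntersectionPoint γ p → (passages γ p).encard = 2)
    (i : Fin n) (hfin : ({t | IsIntersectionPoint γ ((γ i).curve t)} ∩ Ico 0 (γ i).period).Finite) :
    Odd ({t | IsIntersectionPoint γ ((γ i).curve t)} ∩ Ico 0 (γ i).period).ncard ↔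
      Odd (intersectionsWithOthers γ i).ncard := by
  set S := hfin.toFinset with hS
  have hmemS : ∀ t, t ∈ S ↔ IsIntersectionPoint γ ((γ i).curve t) ∧ t ∈ Ico 0 (γ i).period :=
    fun t => hfin.mem_toFinset
  -- Times are grouped by the point visited. The parity of the total is that of the number of odd
  -- fibres; a fibre has two elements at a self-intersection and one at a point shared with another
  -- geodesic.
  rw [ncard_eq_toFinset_card _ hfin, ← hS, Finset.card_eq_sum_card_fiberwise
    (f := (γ i).curve) (t := S.image (γ i).curve)
    (fun t ht => Finset.mem_coe.2 (Finset.mem_image_of_mem _ ht)),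
    Finset.odd_sum_iff_odd_card_odd, ← ncard_coe_finset]
  suffices h : (({p ∈ S.image (γ i).curve | Odd {t ∈ S | (γ i).curve t = p}.card} : Finset M) :
      Set M) = intersectionsWithOthers γ i by rw [h]
  ext p
  simp only [Finset.coe_filter, mem_ofPred_eq]
  constructor
  · rintro ⟨hp, hodd⟩
    obtain ⟨t, ht, rfl⟩ := Finset.mem_image.1 hp
    obtain ⟨hint, htI⟩ := (hmemS t).1 ht
    by_contra hnot
    have hidx : ∀ q ∈ passages γ ((γ i).curve t), q.1 = i := by
      intro q hq
      by_contra hqi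
      exact hnot ⟨⟨t, rfl⟩, q.1, hqi, q.2, hq.2⟩
    obtain ⟨⟨j, x⟩, ⟨k, y⟩, hxy, hpass⟩ := encard_eq_two.1 (hdouble _ hint)
    have hx : (j, x) ∈ passages γ ((γ i).curve t) := by rw [hpass]; simp
    have hy : (k, y) ∈ passages γ ((γ i).curve t) := by rw [hpass]; simp
    obtain rfl : j = i := hidx _ hx
    obtain rfl : k = j := hidx _ hy
    have hne : x ≠ y := fun h => hxy (by rw [h])
    have hfib : {s ∈ S | (γ k).curve s = (γ k).curve t} = {x, y} := by
      ext s
      simp only [Finset.mem_filter, hmemS, Finset.mem_insert, Finset.mem_singleton]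
      constructor
      · rintro ⟨⟨-, hs⟩, hst⟩
        have hmem : (k, s) ∈ passages γ ((γ k).curve t) := ⟨hs, hst⟩
        rw [hpass] at hmem
        simpa using hmem
      · rintro (rfl | rfl)
        · have e : (γ k).curve s = (γ k).curve t := hx.2
          exact ⟨⟨by rwa [e], hx.1⟩, e⟩
        · have e : (γ k).curve s = (γ k).curve t := hy.2
          exact ⟨⟨by rwa [e], hy.1⟩, e⟩
    rw [hfib, Finset.card_pair hne] at hodd
    exact absurd hodd (by decide)
  · intro hp
    have hint := isIntersectionPoint_of_mem_intersectionsWithOthers hp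
    obtain ⟨⟨t, rfl⟩, j, hji, u, hu⟩ := hp
    obtain ⟨t₀, ht₀, -⟩ := exists_passage γ i t
    obtain ⟨u₀, hu₀, -⟩ := exists_passage γ j u
    rw [hu] at hu₀
    have e : (γ i).curve t₀ = (γ i).curve t := ht₀.2
    have hS₀ : t₀ ∈ S := (hmemS t₀).2 ⟨by rwa [e], ht₀.1⟩
    refine ⟨Finset.mem_image.2 ⟨t₀, hS₀, e⟩, ?_⟩
    have hfib : {s ∈ S | (γ i).curve s = (γ i).curve t} = {t₀} := by
      ext s
      simp only [Finset.mem_filter, hmemS, Finset.mem_singleton]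
      constructor
      · rintro ⟨⟨-, hs⟩, hst⟩
        have hmem : (i, s) ∈ passages γ ((γ i).curve t) := ⟨hs, hst⟩
        obtain ⟨x, y, hxy, hpass⟩ := encard_eq_two.1 (hdouble _ hint)
        rw [hpass] at hmem ht₀ hu₀
        simp only [mem_insert_iff, mem_singleton_iff] at hmem ht₀ hu₀
        have h1 : (i, s) ≠ (j, u₀) := fun h => hji (congrArg Prod.fst h).symm
        have h2 : (i, t₀) ≠ (j, u₀) := fun h => hji (congrArg Prod.fst h).symm
        have : (i, s) = (i, t₀) := by grind
        exact congrArg Prod.snd this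
      · rintro rfl
        exact ⟨(hmemS s).1 hS₀, e⟩
    rw [hfib]
    simp

end Counting

end GeodesicAtoms

/-! ### The theorem. -/

open GeodesicAtoms in
theorem mainTheorem2 {M : Type*} [TopologicalSpace M] [T2Space M] [CompactSpace M]
    [ChartedSpace Plane M] [IsManifold 𝓘(ℝ, Plane) ∞ M]
    (g : SurfaceMetric M) (hg : HasConstantCurvature g)
    {n : ℕ} (γ : Fin n → ClosedGeodesic g)
    (hdistinct : ∀ i j, i ≠ j → (γ i).image ≠ (γ j).image)
    (hatom : IsGraphAtom (⋃ i, (γ i).image)) :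
    (∀ p : M, IsIntersectionPoint γ p → IsSimpleIntersection γ p) ∧
      ∀ i, (intersectionsWithOthers γ i).Finite ∧
        (ReversesOrientation (γ i) ↔ Odd (intersectionsWithOthers γ i).ncard) := by
  obtain ⟨Γ, hΓ, -, hdeg, -, color, hcolor⟩ := hatom
  have hvert : ∀ p, IsIntersectionPoint γ p → p ∈ Γ.vertices := fun p hp =>
    mem_vertices_of_isIntersectionPoint hdistinct hΓ hp
  refine ⟨fun p hp => isSimpleIntersection hdistinct hΓ hdeg hp, fun i => ⟨?_, ?_⟩⟩
  · exact Γ.finite_vertices.subset fun p hp =>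
      hvert p (isIntersectionPoint_of_mem_intersectionsWithOthers hp)
  -- Self-intersections belong to `V` as well, because the colours switch there too; they drop out
  -- only in the parity count.
  · set V : Set ℝ := {t | IsIntersectionPoint γ ((γ i).curve t)} with hVdef
    have hV : ∀ a b, (V ∩ Icc a b).Finite := fun a b =>
      ((γ i).finite_preimage_inter_Icc Γ.finite_vertices a b).subset
        (inter_subset_inter_left _ fun t ht => hvert _ ht)
    have h0 : 0 ∈ V ↔ (γ i).period ∈ V := by
      have : (γ i).curve (γ i).period = (γ i).curve 0 := by simpa using (γ i).periodic 0
      simp only [hVdef, mem_ofPred_eq, this]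
    rw [reversesOrientation_iff (γ i) hV
      fun t => exists_isColoredChart hdistinct hΓ hdeg hcolor i t,
      ncard_inter_Ioc_eq_ncard_inter_Ico hV (γ i).period_pos h0]
    exact odd_ncard_passages_iff (fun p hp => passages_encard_eq_two hdistinct hΓ hdeg hp) i
      ((hV 0 (γ i).period).subset (inter_subset_inter_right V Ico_subset_Icc_self))
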